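/- Let $\mathcal Y$ be a finite set, $\phi:\mathcal Y\to\mathbb R^D\setminus\{0\}$, and for $\theta\in\mathbb R^D$ let $\pi_\theta(y)=e^{\langle\phi(y),\theta\rangle}/\sum_{z\in\mathcal Y}e^{\langle\phi(z),\theta\rangle}$ be the linear softmax policy; write $\pi_\theta(S)=\sum_{y\in S}\pi_\theta(y)$ for $S\subseteq\mathcal Y$. For $r:\mathcal Y\to[-1,1]$ let $V_r(\theta)=\sum_y\pi_\theta(y)r(y)$. Maximizing $r$ from $\theta_0$ means following the gradient flow $\frac{d}{dt}\theta_t=\nabla V_r(\theta_t)$, $t\ge0$, started at $\theta_0$. Let $r_G:\mathcal Y\to[-1,1]$ and $\mathcal Y=\{y_\star,y_{\rm med}\}\cup\mathcal Y_{\rm bad}$ with $\mathcal Y_{\rm bad}\neq\emptyset$, $r_G(y_\star)>r_G(y_{\rm med})>0\ge r_G(y)$ for all $y\in\mathcal Y_{\rm bad}$, and $r_G$ constant on $\mathcal Y_{\rm bad}$. Suppose $\langle\phi(y_\star),\phi(y_{\rm med})\rangle<0$, $\langle\phi(z),\phi(y)\rangle=0$ for all $z\in\mathcal Y_{\rm bad}$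 and $y\neq z$, and $\|\phi(z)\|\le\|\phi(y_{\rm med})\|$ for all $z\in\mathcal Y_{\rm bad}$. Put $\Delta_1=r_G(y_\star)-r_G(y_{\rm med})$, $\Delta_2=r_G(y_{\rm med})-r_G(y_{\rm bad})$ for any $y_{\rm bad}\in\mathcal Y_{\rm bad}$, $B=\max_y\|\phi(y)\|$, $$M'=\min\Big\{1,\frac{\|\phi(y_{\rm med})\|^2r_G(y_{\rm med})^{2/7}}{40B^2(\Delta_1+\Delta_2)}\Big\},\qquad \alpha=\frac{-\langle\phi(y_\star),\phi(y_{\rm med})\rangle}{26\big(\|\phi(y_{\rm med})\|^2-\tfrac12\langle\phi(y_\star),\phi(y_{\rm med})\rangle\big)} .$$ Let $r_P$ agree with $r_G$ except that $r_P(y_{\rm med})=\min_{y\in\mathcal Y_{\rm bad}}r_G(y)$. Fix $\epsilon\in(0,\Delta_1)$. Call $\theta_0\in\mathbb R^D$ admissible if $$\pi_{\theta_0}(y_\star)<\min\Big\{M'\min\Big\{0.01,\Big(\tfrac{21\|\phi(y_{\rm med})\|^2}{1100B^2(\Delta_1+\Delta_2)}\Big)^{7/3}\Big\}^{13/14},\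 \tfrac{\|\phi(y_{\rm med})\|}{\|\phi(y_\star)\|}\pi_{\theta_0}(y_{\rm med})\Big\},$$ $$\max\Big\{\frac{2\pi_{\theta_0}(y_\star)^{7/13}}{\Delta_2M'^{7/13}},\,0.05\,r_G(y_{\rm med})\Big\}\le\pi_{\theta_0}(\mathcal Y_{\rm bad})\le0.1\,r_G(y_{\rm med}).$$ Let $t_\star$ and $t_\star^{\text{no-med}}$, both in $[0,\infty]$, be the first times at which $V_{r_G}(\theta_t)\ge r_G(y_\star)-\epsilon$ when maximizing $r_G$ and $r_P$, respectively, from $\theta_0$ ($\infty$ if this never happens). Then $\alpha\in(0,1/13)$ and the following hold. 1. For every admissible $\theta_0$, $$t_\star\ge\frac{r_G(y_{\rm med})M'^{14/13+\alpha}\big(1-e^{-2(\Delta_1-\epsilon)}\big)}{4B^2(\Delta_1+\Delta_2)K}\,\pi_{\theta_0}(y_\star)^{-14/13-\alpha},$$ where $$K=\Big(\frac{26}{r_G(y_{\rm med})^2}\Big)^{13\alpha/7}\Big(1+\frac{\|\phi(y_{\rm med})\|^2\pi_{\theta_0}(y_{\rm med})^2}{8\big(\|\phi(y_\star)\|^2-\langle\phi(y_\star),\phi(y_{\rm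 med})\rangle\big)\big(r_G(y_\star)-V_{r_G}(\theta_0)\big)}\Big).$$ Moreover there is $c>0$, independent of $\theta_0$, with $t_\star\ge c\,\pi_{\theta_0}(y_\star)^{-14/13-\alpha}$ for every admissible $\theta_0$. 2. For every admissible $\theta_0$, $$t_\star^{\text{no-med}}\le\frac{(r_G(y_\star)+1)^2}{\epsilon^2\big(r_P(y_\star)-V_{r_P}(\theta_0)\big)\|\phi(y_\star)\|^2}\,\pi_{\theta_0}(y_\star)^{-1}.$$ Moreover there is $C>0$, independent of $\theta_0$, with $t_\star^{\text{no-med}}\le C\,\pi_{\theta_0}(y_\star)^{-1}$ for every admissible $\theta_0$. This rate is of smaller order than that of part 1: $p^{-1}=o(p^{-14/13-\alpha})$ as $p\downarrow0$. 3. For every $T>0$ there is $\delta>0$, independent of $\theta_0$, such that $t_\star-t_\star^{\text{no-med}}\ge T$ for every admissible $\theta_0$ with $\pi_{\theta_0}(y_\star)<\delta$. -/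

import Mathlib

open scoped ENNReal Topology

noncomputable section

namespace SoftmaxFlow

variable {Y : Type*} [Fintype Y] {D : ℕ}

/-- The linear softmax policy `π_θ(y) = exp⟨φ(y), θ⟩ / ∑_z exp⟨φ(z), θ⟩`. -/
def policy (φ : Y → EuclideanSpace ℝ (Fin D)) (θ : EuclideanSpace ℝ (Fin D)) (y : Y) : ℝ :=
  Real.exp (inner ℝ (φ y) θ) / ∑ z, Real.exp (inner ℝ (φ z) θ)

/-- The expected reward `V(θ) = E_{y ∼ π_θ}[r(y)]`. -/
def expectedReward (φ : Y → EuclideanSpace ℝ (Fin D)) (r : Y → ℝ)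
    (θ : EuclideanSpace ℝ (Fin D)) : ℝ :=
  ∑ y, policy φ θ y * r y

/-- The advantage `A(y; θ) = r(y) - V(θ)`. -/
def advantage (φ : Y → EuclideanSpace ℝ (Fin D)) (r : Y → ℝ)
    (θ : EuclideanSpace ℝ (Fin D)) (y : Y) : ℝ :=
  r y - expectedReward φ r θ

/-- `θ` is a gradient flow trajectory maximizing the expected reward with respect to `r`:
`θ(0) = θ₀` and `dθ/dt = ∇V(θ(t))` for all `t ≥ 0` (one-sided derivative at `t = 0`). -/
structure IsGradientFlow (φ : Y → EuclideanSpace ℝ (Fin D)) (r : Y → ℝ)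
    (θ₀ : EuclideanSpace ℝ (Fin D)) (θ : ℝ → EuclideanSpace ℝ (Fin D)) : Prop where
  initial : θ 0 = θ₀
  flow : ∀ t : ℝ, 0 ≤ t →
    HasDerivWithinAt θ (gradient (expectedReward φ r) (θ t)) (Set.Ici 0) t

/-- The initial time `t ≥ 0` at which the expected reward with respect to `r` along the
trajectory `θ` is at least `c`; it is `∞` if this never happens. -/
def initialTime (φ : Y → EuclideanSpace ℝ (Fin D)) (r : Y → ℝ)
    (θ : ℝ → EuclideanSpace ℝ (Fin D)) (c : ℝ) : ℝ≥0∞ :=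
  ⨅ t ∈ {t : ℝ | 0 ≤ t ∧ c ≤ expectedReward φ r (θ t)}, ENNReal.ofReal t

/-- The assumption on the ground truth reward. -/
structure RewardStructure [DecidableEq Y] (r : Y → ℝ) (ystar ymed : Y) (Ybad : Finset Y) :
    Prop where
  cover : (Finset.univ : Finset Y) = {ystar, ymed} ∪ Ybad
  star_gt_med : r ymed < r ystar
  med_pos : 0 < r ymed
  bad_nonpos : ∀ y ∈ Ybad, r y ≤ 0
  bad_const : ∀ y ∈ Ybad, ∀ y' ∈ Ybad, r y = r y'

/-- The assumption on the feature vectors. -/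
structure FeatureStructure (φ : Y → EuclideanSpace ℝ (Fin D)) (ystar ymed : Y)
    (Ybad : Finset Y) : Prop where
  inner_neg : inner ℝ (φ ystar) (φ ymed) < 0
  bad_orthogonal : ∀ z ∈ Ybad, ∀ y : Y, y ≠ z → inner ℝ (φ z) (φ y) = 0
  bad_norm_le : ∀ z ∈ Ybad, ‖φ z‖ ≤ ‖φ ymed‖

/-- `B = max_y ‖φ(y)‖` (a supremum over a finite index type). -/
def featureBound (φ : Y → EuclideanSpace ℝ (Fin D)) : ℝ := ⨆ y, ‖φ y‖

/-- `Δ₁ = r(y⋆) - r(y_med)`. -/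
def gapStar (r : Y → ℝ) (ystar ymed : Y) : ℝ := r ystar - r ymed

/-- `Δ₂ = r(y_med) - r(y_bad)`. -/
def gapBad (r : Y → ℝ) (ymed ybad : Y) : ℝ := r ymed - r ybad

/-- `M' = min {1, ‖φ(y_med)‖² r(y_med)^{2/7} (40 B² (Δ₁ + Δ₂))⁻¹}`. -/
def constM (φ : Y → EuclideanSpace ℝ (Fin D)) (r : Y → ℝ) (ystar ymed ybad : Y) : ℝ :=
  min 1 (‖φ ymed‖ ^ 2 * r ymed ^ (2 / 7 : ℝ) *
    (40 * featureBound φ ^ 2 * (gapStar r ystar ymed + gapBad r ymed ybad))⁻¹)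

/-- The assumption on the initial policy. -/
structure InitialPolicy (φ : Y → EuclideanSpace ℝ (Fin D)) (r : Y → ℝ)
    (ystar ymed : Y) (Ybad : Finset Y) (ybad : Y) (θ₀ : EuclideanSpace ℝ (Fin D)) : Prop where
  star_lt : policy φ θ₀ ystar <
    min
      (constM φ r ystar ymed ybad *
        (min 0.01
          ((21 * ‖φ ymed‖ ^ 2 / (1100 * featureBound φ ^ 2 *
            (gapStar r ystar ymed + gapBad r ymed ybad))) ^ (7 / 3 : ℝ))) ^ (13 / 14 : ℝ))
      (‖φ ymed‖ / ‖φ ystar‖ * policy φ θ₀ ymed)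
  bad_lower :
    max
      (2 * policy φ θ₀ ystar ^ (7 / 13 : ℝ) /
        (gapBad r ymed ybad * constM φ r ystar ymed ybad ^ (7 / 13 : ℝ)))
      (0.05 * r ymed) ≤ ∑ z ∈ Ybad, policy φ θ₀ z
  bad_upper : ∑ z ∈ Ybad, policy φ θ₀ z ≤ 0.1 * r ymed

/-- `α = -⟨φ(y⋆), φ(y_med)⟩ / (26 (‖φ(y_med)‖² - 0.5 ⟨φ(y⋆), φ(y_med)⟩))`. -/
def constAlpha (φ : Y → EuclideanSpace ℝ (Fin D)) (ystar ymed : Y) : ℝ :=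
  -inner ℝ (φ ystar) (φ ymed) /
    (26 * (‖φ ymed‖ ^ 2 - 0.5 * inner ℝ (φ ystar) (φ ymed)))

/-- `K = (26 / r(y_med)²)^{13α/7} (1 + ‖φ(y_med)‖² π_{θ₀}(y_med)² /
(8 (‖φ(y⋆)‖² - ⟨φ(y⋆), φ(y_med)⟩) A(y⋆; θ₀)))`. -/
def constK (φ : Y → EuclideanSpace ℝ (Fin D)) (r : Y → ℝ) (ystar ymed : Y)
    (θ₀ : EuclideanSpace ℝ (Fin D)) : ℝ :=
  (26 / r ymed ^ 2) ^ (13 * constAlpha φ ystar ymed / 7) *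
    (1 + ‖φ ymed‖ ^ 2 * policy φ θ₀ ymed ^ 2 /
      (8 * (‖φ ystar‖ ^ 2 - inner ℝ (φ ystar) (φ ymed)) * advantage φ r θ₀ ystar))

end SoftmaxFlow

end

/-! Write `s`, `m`, `β` for the probabilities of the best outcome, the medium one and the bad set,
`p` for the initial value of `s`, and `b = ‖φ ymed‖ ^ 2`. The advantages have mean zero under the
policy, so with `X = m A(med)`, `δ = s A(star)`, `E = -A(bad)` one has `β E = X + δ`.

Lower bound, phase one. While `β` is not too small, `X b` dominates every term carrying `δ`: the
flow mainly feeds the medium outcome, at the expense of the best one. Then `log s` falls at rate at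
least `0.7 X b` (`Levels.log_star_le`) and `log β` at rate at most `2.03 X b`
(`Levels.log_bad_bounds`), so `s / β ^ γ` is nonincreasing for every `γ` in `[0, 2/7]`. The expected
reward stays below `r ymed` until `β` has dropped to order `p ^ (7/13)`, and by then `s` is at most
of order `p ^ (1 + 7γ/13)` (`exists_star_small`). The choice `γ = 1/7 + 13α/7` gives the exponent
`14/13 + α`; `α < 1/13` is what makes `γ < 2/7`.

Lower bound, phase two. The expected reward is monotone along the flow, which bounds `A(med)` for
all time and yields `s' ≤ κ s ^ 2` (`inv_star_growth`). From the depleted value of `s`, a time of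
order its inverse passes before `s` doubles; until then the reward climbs above `r ymed` only at
speed of order `s ^ 2` (`le_time_of_star_small`).

Upper bound. The proxy reward takes two values, so its expectation is affine in `s`, and
Cauchy–Schwarz against `φ ystar` gives `s' ≥ κ' s ^ 2` as long as `s` is bounded away from 1. Hence
`s` is close to 1 by a time of order `1 / p` (`exists_star_large`). The gap between the two times
follows from `1 / p = o(p ^ (-14/13 - α))`. -/

namespace SoftmaxFlow

/-! ### Derivatives of the softmax policy and of the expected reward along the flow. -/

section Calculus

variable {Y : Type*} [Fintype Y] {D : ℕ} (φ : Y → EuclideanSpace ℝ (Fin D)) (r : Y → ℝ)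
  (θ : EuclideanSpace ℝ (Fin D))

lemma partition_pos [Nonempty Y] : 0 < ∑ z, Real.exp (inner ℝ (φ z) θ) :=
  Finset.sum_pos (fun _ _ => Real.exp_pos _) Finset.univ_nonempty

lemma policy_pos [Nonempty Y] (y : Y) : 0 < policy φ θ y :=
  div_pos (Real.exp_pos _) (partition_pos φ θ)

lemma sum_policy [Nonempty Y] : ∑ y, policy φ θ y = 1 := by
  simp only [policy, ← Finset.sum_div]
  exact div_self (partition_pos φ θ).ne'

/-- The gradient of the expected reward, `∑_y π(y) A(y) φ(y)`. -/
noncomputable def drift : EuclideanSpace ℝ (Fin D) :=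
  ∑ y, (policy φ θ y * advantage φ r θ y) • φ y

lemma hasFDerivAt_policy [Nonempty Y] (y : Y) :
    HasFDerivAt (fun θ => policy φ θ y)
      (innerSL ℝ (policy φ θ y • (φ y - ∑ z, policy φ θ z • φ z))) θ := by
  have hexp : ∀ z, HasFDerivAt (fun θ => Real.exp (inner ℝ (φ z) θ))
      (Real.exp (inner ℝ (φ z) θ) • innerSL ℝ (φ z)) θ := fun z =>
    ((innerSL ℝ (φ z)).hasFDerivAt (x := θ)).exp
  have hZ := HasFDerivAt.fun_sum (u := Finset.univ) fun z _ => hexp z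
  have hpos := (partition_pos φ θ).ne'
  have h := (hexp y).mul ((hasDerivAt_inv hpos).comp_hasFDerivAt θ hZ)
  refine HasFDerivAt.congr_fderiv (f := fun θ => policy φ θ y) h ?_
  ext v
  have hsum : ∀ f : Y → ℝ, ∑ z, policy φ θ z * f z =
      (∑ z, Real.exp (inner ℝ (φ z) θ) * f z) / ∑ z, Real.exp (inner ℝ (φ z) θ) := fun f => by
    simp only [policy, div_mul_eq_mul_div, ← Finset.sum_div]
  simp only [add_apply, smul_apply, sum_apply, innerSL_apply_apply,
    smul_eq_mul, real_inner_smul_left, inner_sub_left, sum_inner, hsum, Function.comp_apply]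
  simp only [policy]
  field_simp
  ring

/-- Centring the features, as the softmax derivative does, is the same as centring the rewards: `∑ π
r (φ - 𝔼φ) = ∑ π (r - V) φ`. -/
lemma gradient_expectedReward [Nonempty Y] :
    HasGradientAt (expectedReward φ r) (drift φ r θ) θ := by
  rw [hasGradientAt_iff_hasFDerivAt]
  have h := HasFDerivAt.fun_sum (u := Finset.univ) fun y _ =>
    (hasFDerivAt_policy φ θ y).mul_const (r y)
  refine HasFDerivAt.congr_fderiv (f := expectedReward φ r) h ?_
  ext v
  simp only [sum_apply, smul_apply, innerSL_apply_apply,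
    InnerProductSpace.toDual_apply_apply, drift, sum_inner, real_inner_smul_left, inner_sub_left,
    smul_eq_mul, advantage]
  have h1 : ∀ y, r y * (policy φ θ y * (inner ℝ (φ y) v - ∑ z, policy φ θ z * inner ℝ (φ z) v))
      = policy φ θ y * r y * inner ℝ (φ y) v
        - policy φ θ y * r y * ∑ z, policy φ θ z * inner ℝ (φ z) v := fun y => by ring
  have h2 : ∀ y, policy φ θ y * (r y - expectedReward φ r θ) * inner ℝ (φ y) v
      = policy φ θ y * r y * inner ℝ (φ y) v
        - expectedReward φ r θ * (policy φ θ y * inner ℝ (φ y) v) := fun y => by ring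
  simp only [h1, h2, Finset.sum_sub_distrib, ← Finset.sum_mul, ← Finset.mul_sum]
  rfl

variable {φ r} {θ₀ : EuclideanSpace ℝ (Fin D)} {ϑ : ℝ → EuclideanSpace ℝ (Fin D)}

lemma IsGradientFlow.hasDerivWithinAt_policy [Nonempty Y] (h : IsGradientFlow φ r θ₀ ϑ) (y : Y)
    {t : ℝ} (ht : 0 ≤ t) :
    HasDerivWithinAt (fun t => policy φ (ϑ t) y)
      (policy φ (ϑ t) y * (inner ℝ (φ y) (drift φ r (ϑ t)) -
        ∑ z, policy φ (ϑ t) z * inner ℝ (φ z) (drift φ r (ϑ t)))) (Set.Ici 0) t := by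
  have h1 := h.flow t ht
  rw [(gradient_expectedReward φ r (ϑ t)).gradient] at h1
  refine ((hasFDerivAt_policy φ (ϑ t) y).comp_hasDerivWithinAt t h1).congr_deriv ?_
  simp only [innerSL_apply_apply, real_inner_smul_left, inner_sub_left, sum_inner]

lemma IsGradientFlow.hasDerivWithinAt_expectedReward [Nonempty Y] (h : IsGradientFlow φ r θ₀ ϑ)
    {t : ℝ} (ht : 0 ≤ t) :
    HasDerivWithinAt (fun t => expectedReward φ r (ϑ t)) (‖drift φ r (ϑ t)‖ ^ 2) (Set.Ici 0) t := by
  have h1 := h.flow t ht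
  rw [(gradient_expectedReward φ r (ϑ t)).gradient] at h1
  have h2 := (gradient_expectedReward φ r (ϑ t)).hasFDerivAt.comp_hasDerivWithinAt t h1
  refine h2.congr_deriv ?_
  rw [InnerProductSpace.toDual_apply_apply, real_inner_self_eq_norm_sq]

end Calculus

/-- A function on `[0, ∞)` whose derivative is nonpositive on `(a, b)` satisfies `f b ≤ f a`. -/
lemma le_of_hasDerivWithinAt_nonpos {f f' : ℝ → ℝ} {a b : ℝ} (ha : 0 ≤ a) (hab : a ≤ b)
    (hf : ∀ t, 0 ≤ t → HasDerivWithinAt f (f' t) (Set.Ici 0) t)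
    (hf' : ∀ t, a < t → t < b → f' t ≤ 0) : f b ≤ f a := by
  have hanti : AntitoneOn f (Set.Icc a b) := by
    refine antitoneOn_of_hasDerivWithinAt_nonpos (f' := f') (convex_Icc a b) ?_ ?_ ?_
    · intro t ht
      exact ((hf t (ha.trans ht.1)).continuousWithinAt).mono fun x hx => ha.trans hx.1
    · intro t ht
      rw [interior_Icc] at ht ⊢
      exact (hf t (ha.trans ht.1.le)).mono fun x hx => ha.trans hx.1.le
    · intro t ht
      rw [interior_Icc] at ht
      exact hf' t ht.1 ht.2
  exact hanti (Set.left_mem_Icc.2 hab) (Set.right_mem_Icc.2 hab) hab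

lemma IsGradientFlow.expectedReward_mono {Y : Type*} [Fintype Y] [Nonempty Y] {D : ℕ}
    {φ : Y → EuclideanSpace ℝ (Fin D)} {r : Y → ℝ} {θ₀ : EuclideanSpace ℝ (Fin D)}
    {ϑ : ℝ → EuclideanSpace ℝ (Fin D)} (h : IsGradientFlow φ r θ₀ ϑ) {a b : ℝ} (ha : 0 ≤ a)
    (hab : a ≤ b) : expectedReward φ r (ϑ a) ≤ expectedReward φ r (ϑ b) := by
  have := le_of_hasDerivWithinAt_nonpos ha hab
    (fun t ht => (h.hasDerivWithinAt_expectedReward ht).neg)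
    (fun t _ _ => neg_nonpos.2 (sq_nonneg _))
  simpa using this

end SoftmaxFlow

/-! ### Inequalities for a policy with three reward levels. -/

namespace SoftmaxFlow

/-- It suffices that `0.1 ^ 6 < 0.15 ^ 7`. The bound serves to compare `w ^ 13 = w ^ 7 * w ^ 6`, the
scale of `s`, with `w ^ 7`, the scale of `D₂ β`. -/
lemma pow_six_le_of_pow_seven_le {w : ℝ} (hw : 0 ≤ w) (h : w ^ 7 ≤ 0.1) : w ^ 6 ≤ 0.15 := by
  by_contra! hc
  have h1 : (w ^ 7) ^ 6 ≤ 0.1 ^ 6 := pow_le_pow_left₀ (by positivity) h 6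
  have h2 : (0.15 : ℝ) ^ 7 ≤ (w ^ 6) ^ 7 := pow_le_pow_left₀ (by norm_num) hc.le 7
  have h3 : (w ^ 7) ^ 6 = (w ^ 6) ^ 7 := by ring
  rw [h3] at h1
  have := h2.trans h1
  norm_num at this

/-- The configuration of a policy with three reward levels: probabilities `s`, `m`, `β` of the best,
the medium and the bad outcomes, gaps `D₁`, `D₂`, squared norms `a`, `b` and `-c` the inner product
of the first two feature vectors, `Q` the sum of `π(z)² ‖φ(z)‖²` over bad `z`. -/
structure Levels (s m β D₁ D₂ a b c Q N : ℝ) : Prop where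
  s_pos : 0 < s
  m_pos : 0 < m
  β_pos : 0 < β
  sum_eq : s + m + β = 1
  D₁_pos : 0 < D₁
  D₂_pos : 0 < D₂
  a_nonneg : 0 ≤ a
  b_nonneg : 0 ≤ b
  c_nonneg : 0 ≤ c
  a_le : a ≤ N
  b_le : b ≤ N
  c_le : c ≤ N
  Q_nonneg : 0 ≤ Q
  Q_le : Q ≤ b * β ^ 2

/-- The expected drift of the log-weights, in terms of the weighted advantages
`X = m A(med)`, `δ = s A(star)` and `E = -A(bad)`. -/
def meanDrift (s m a b c Q X δ E : ℝ) : ℝ :=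
  s * (δ * a - X * c) + m * (X * b - δ * c) - E * Q

variable {s m β D₁ D₂ a b c Q N X δ E : ℝ}

lemma Levels.balance (_h : Levels s m β D₁ D₂ a b c Q N)
    (hX : X = m * (D₂ * β - D₁ * s)) (hδ : δ = s * (D₁ * m + (D₁ + D₂) * β))
    (hE : E = (D₁ + D₂) * s + D₂ * m) : β * E = X + δ := by
  subst hX hδ hE; ring

/-- While the bad outcomes carry enough mass, the medium outcome absorbs probability. -/
lemma Levels.med_dominates (h : Levels s m β D₁ D₂ a b c Q N)
    (hX : X = m * (D₂ * β - D₁ * s)) (hδ : δ = s * (D₁ * m + (D₁ + D₂) * β))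
    {w M : ℝ} (hw : 0 < w) (hM1 : M ≤ 1) (hMN : M * N * (D₁ + D₂) ≤ b / 40)
    (hw1 : w ^ 7 ≤ 0.1) (hw2 : w ^ 7 ≤ 0.05 * (D₁ + D₂)) (hD₁ : D₁ ≤ 1)
    (hβ1 : w ^ 7 ≤ D₂ * β) (hβ2 : β ≤ 0.11) (hs : s ≤ 2 * (M * w ^ 13)) :
    0 < X ∧ s ≤ 0.03 ∧ s * N ≤ 0.01 * b ∧ δ * N ≤ 0.0125 * (X * b) ∧ 0.86 ≤ m ∧
      0 < D₂ * β - D₁ * s := by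
  obtain ⟨s_pos, m_pos, β_pos, sum_eq, D₁_pos, D₂_pos, a_nonneg, b_nonneg, c_nonneg, a_le, b_le,
    c_le, Q_nonneg, Q_le⟩ := h
  have hw6 := pow_six_le_of_pow_seven_le hw.le hw1
  have h7 : 0 < w ^ 7 := by positivity
  have h6 : 0 < w ^ 6 := by positivity
  have hw13 : w ^ 13 = w ^ 7 * w ^ 6 := by ring
  have hN : 0 ≤ N := a_nonneg.trans a_le
  have h13 : w ^ 13 ≤ w ^ 7 * 0.15 := by rw [hw13]; gcongr
  have hsw : s ≤ 0.3 * w ^ 7 := by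
    have : M * w ^ 13 ≤ 1 * w ^ 13 := by gcongr
    linarith
  have hs3 : s ≤ 0.03 := by linarith
  have hm : 0.86 ≤ m := by linarith
  have hAm : 0.7 * w ^ 7 ≤ D₂ * β - D₁ * s := by
    have : D₁ * s ≤ 1 * s := by gcongr
    linarith
  have hXw : 0.6 * w ^ 7 ≤ X := by
    have : 0.86 * (0.7 * w ^ 7) ≤ m * (D₂ * β - D₁ * s) := by gcongr
    rw [hX]; linarith
  -- The factor `M` enters here: it makes the contribution of the best outcome small relative to
  -- `b`, although `N` may be much larger than `b`.
  have hsN : s * N * (D₁ + D₂) ≤ w ^ 13 * (b / 20) := by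
    calc s * N * (D₁ + D₂) ≤ 2 * (M * w ^ 13) * N * (D₁ + D₂) := by gcongr
      _ = 2 * w ^ 13 * (M * N * (D₁ + D₂)) := by ring
      _ ≤ 2 * w ^ 13 * (b / 40) := by gcongr
      _ = _ := by ring
  have hsN' : s * N ≤ 0.01 * b := by
    have h1 : w ^ 13 * (b / 20) ≤ (D₁ + D₂) * (0.01 * b) := by
      calc w ^ 13 * (b / 20) ≤ (w ^ 7 * 0.15) * (b / 20) := by gcongr
        _ ≤ (0.05 * (D₁ + D₂) * 0.15) * (b / 20) := by gcongr
        _ ≤ (D₁ + D₂) * (0.01 * b) := by nlinarith [mul_nonneg (add_pos D₁_pos D₂_pos).le b_nonneg]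
    have h2 : (D₁ + D₂) * (s * N) ≤ (D₁ + D₂) * (0.01 * b) := by linarith
    exact le_of_mul_le_mul_left h2 (by positivity)
  have hδs : δ ≤ s * (D₁ + D₂) := by
    rw [hδ]
    have h1 : D₁ * m + (D₁ + D₂) * β ≤ D₁ + D₂ := by nlinarith
    gcongr
  have hδN : δ * N ≤ 0.0125 * (X * b) := by
    calc δ * N ≤ s * (D₁ + D₂) * N := by gcongr
      _ = s * N * (D₁ + D₂) := by ring
      _ ≤ w ^ 13 * (b / 20) := hsN
      _ ≤ (w ^ 7 * 0.15) * (b / 20) := by gcongr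
      _ = 0.0125 * (0.6 * w ^ 7 * b) := by ring
      _ ≤ _ := by gcongr
  exact ⟨by linarith, hs3, hsN', hδN, hm, by linarith⟩

lemma Levels.δ_nonneg (h : Levels s m β D₁ D₂ a b c Q N)
    (hδ : δ = s * (D₁ * m + (D₁ + D₂) * β)) : 0 ≤ δ := by
  obtain ⟨s_pos, m_pos, β_pos, sum_eq, D₁_pos, D₂_pos, a_nonneg, b_nonneg, c_nonneg, a_le, b_le,
    c_le, Q_nonneg, Q_le⟩ := h
  subst hδ; positivity

lemma Levels.E_nonneg (h : Levels s m β D₁ D₂ a b c Q N)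
    (hE : E = (D₁ + D₂) * s + D₂ * m) : 0 ≤ E := by
  obtain ⟨s_pos, m_pos, β_pos, sum_eq, D₁_pos, D₂_pos, a_nonneg, b_nonneg, c_nonneg, a_le, b_le,
    c_le, Q_nonneg, Q_le⟩ := h
  subst hE; positivity

/-- One factor `β` of `Q ≤ b β²` is spent on the balance `β E = X + δ`, so the self-repulsion of the
bad outcomes is `β` times a quantity of the size of the medium drift. -/
lemma Levels.E_mul_Q_le (h : Levels s m β D₁ D₂ a b c Q N)
    (hE : E = (D₁ + D₂) * s + D₂ * m) (hbal : β * E = X + δ) : E * Q ≤ b * β * (X + δ) := by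
  have hE0 := h.E_nonneg hE
  calc E * Q ≤ E * (b * β ^ 2) := by gcongr; exact h.Q_le
    _ = b * β * (β * E) := by ring
    _ = _ := by rw [hbal]

/-- The mean drift contains `m X b ≥ 0.86 X b`; the bad outcomes give back at most `0.11 X b`, and
the terms in `δ` cost at most `2.11 * 0.0125 X b`. The term `-X c` only helps. -/
lemma Levels.log_star_le (h : Levels s m β D₁ D₂ a b c Q N)
    (hδ : δ = s * (D₁ * m + (D₁ + D₂) * β))
    (hE : E = (D₁ + D₂) * s + D₂ * m) (hbal : β * E = X + δ) (hX : 0 < X)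
    (hs : s ≤ 0.03) (hδN : δ * N ≤ 0.0125 * (X * b)) (hm : 0.86 ≤ m) (hβ : β ≤ 0.11) :
    (δ * a - X * c) - meanDrift s m a b c Q X δ E ≤ -(0.7 * (X * b)) := by
  have hδ0 := h.δ_nonneg hδ
  have hEQ := h.E_mul_Q_le hE hbal
  obtain ⟨s_pos, m_pos, β_pos, sum_eq, D₁_pos, D₂_pos, a_nonneg, b_nonneg, c_nonneg, a_le, b_le,
    c_le, Q_nonneg, Q_le⟩ := h
  have hN : 0 ≤ N := a_nonneg.trans a_le
  unfold meanDrift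
  have h1 : (1 - s) * (δ * a) ≤ 1 * (δ * N) := by gcongr; linarith
  have h2 : 0 ≤ (1 - s) * (X * c) := mul_nonneg (by linarith) (by positivity)
  have h3 : 0.86 * (X * b) ≤ m * (X * b) := by gcongr
  have h4 : m * (δ * c) ≤ 1 * (δ * N) := by gcongr; linarith
  have h5 : b * β * (X + δ) ≤ 0.11 * (X * b) + 0.11 * (δ * N) := by
    have e1 : b * β * (X + δ) = β * (X * b) + β * (δ * b) := by ring
    rw [e1]; gcongr
  have hXb : 0 ≤ X * b := by positivity
  linarith

/-- The bad outcomes lose about `X b` at most through their own negative advantage and `X b` at most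
through normalization, whence `2` plus an error. The sign holds since `E Q ≤ E Q / β` and the mean
drift without its `Q` term is positive up to small errors. -/
lemma Levels.log_bad_bounds (h : Levels s m β D₁ D₂ a b c Q N)
    (hδ : δ = s * (D₁ * m + (D₁ + D₂) * β))
    (hE : E = (D₁ + D₂) * s + D₂ * m) (hbal : β * E = X + δ) (hX : 0 < X)
    (hs : s ≤ 0.03) (hsN : s * N ≤ 0.01 * b) (hδN : δ * N ≤ 0.0125 * (X * b)) (hm : 0.86 ≤ m) :
    -(2.03 * (X * b)) ≤ -(E * Q / β) - meanDrift s m a b c Q X δ E ∧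
      -(E * Q / β) - meanDrift s m a b c Q X δ E ≤ 0 := by
  have hδ0 := h.δ_nonneg hδ
  have hE0 := h.E_nonneg hE
  have hEQ := h.E_mul_Q_le hE hbal
  obtain ⟨s_pos, m_pos, β_pos, sum_eq, D₁_pos, D₂_pos, a_nonneg, b_nonneg, c_nonneg, a_le, b_le,
    c_le, Q_nonneg, Q_le⟩ := h
  have hN : 0 ≤ N := a_nonneg.trans a_le
  have hXb : 0 ≤ X * b := by positivity
  have h1 : E * Q / β ≤ b * (X + δ) := by
    rw [div_le_iff₀ β_pos]; linarith
  have h2 : E * Q ≤ E * Q / β := by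
    rw [le_div_iff₀ β_pos]
    exact mul_le_of_le_one_right (by positivity) (by linarith)
  have h3 : 0 ≤ E * Q := by positivity
  unfold meanDrift
  have h4 : δ * b ≤ δ * N := by gcongr
  have h5 : s * (δ * a) ≤ 0.03 * (δ * N) := by gcongr
  have h6 : m * (X * b) ≤ 1 * (X * b) := by gcongr; linarith
  have h7 : 0 ≤ s * (X * c) := by positivity
  have h8 : 0 ≤ m * (δ * c) := by positivity
  constructor
  · linarith
  · have h9 : s * (X * c) ≤ 0.01 * (X * b) := by
      calc s * (X * c) ≤ s * (X * N) := by gcongr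
        _ = X * (s * N) := by ring
        _ ≤ X * (0.01 * b) := by gcongr
        _ = _ := by ring
    have h10 : 0.86 * (X * b) ≤ m * (X * b) := by gcongr
    have h11 : m * (δ * c) ≤ 1 * (δ * N) := by gcongr; linarith
    have h12 : 0 ≤ s * (δ * a) := by positivity
    linarith

/-- The relative growth of the probability of the best outcome is of the order of that
probability, provided that the advantage of the medium outcome is at most `D₂ / 4`. -/
lemma Levels.log_star_growth (h : Levels s m β D₁ D₂ a b c Q N)
    (hX : X = m * (D₂ * β - D₁ * s)) (hδ : δ = s * (D₁ * m + (D₁ + D₂) * β))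
    (hE : E = (D₁ + D₂) * s + D₂ * m) (hA : D₂ * β - D₁ * s ≤ D₂ / 4) :
    (δ * a - X * c) - meanDrift s m a b c Q X δ E ≤ 5 * N * (D₁ + D₂) * s := by
  have hδ0 := h.δ_nonneg hδ
  have hE0 := h.E_nonneg hE
  have hbal := h.balance hX hδ hE
  have hEQ := h.E_mul_Q_le hE hbal
  obtain ⟨s_pos, m_pos, β_pos, sum_eq, D₁_pos, D₂_pos, a_nonneg, b_nonneg, c_nonneg, a_le, b_le,
    c_le, Q_nonneg, Q_le⟩ := h
  have hN : 0 ≤ N := a_nonneg.trans a_le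
  have hδs : δ * N ≤ s * (D₁ + D₂) * N := by
    have h1 : D₁ * m + (D₁ + D₂) * β ≤ D₁ + D₂ := by nlinarith
    rw [hδ]; gcongr
  have hs1 : s ≤ 1 := by linarith
  have hm1 : m ≤ 1 := by linarith
  have hβ1 : β ≤ 1 := by linarith
  unfold meanDrift
  have h1 : (1 - s) * (δ * a) ≤ 1 * (δ * N) := by gcongr; linarith
  have h2 : m * (δ * c) ≤ 1 * (δ * N) := by gcongr
  have h3 : β * (δ * b) ≤ 1 * (δ * N) := by gcongr
  have hK : 0 ≤ s * (D₁ + D₂) * N := by positivity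
  -- After `E Q ≤ b β (X + δ)`, the only positive contribution of `X ≥ 0` is `β X b`. It is absorbed
  -- by `m X b` if `β ≤ m`; otherwise `β > (1 - s) / 2`, and the bound `D₂ / 4` on the advantage
  -- forces that advantage below `(D₁ + D₂) s`.
  rcases le_or_gt 0 X with hX0 | hX0
  · have h4 : 0 ≤ (1 - s) * (X * c) := mul_nonneg (by linarith) (by positivity)
    rcases le_or_gt β m with hβm | hβm
    · have h5 : β * (X * b) ≤ m * (X * b) := by gcongr
      linarith
    · have hA0 : D₂ * β - D₁ * s ≤ (D₁ + D₂) * s := by nlinarith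
      have hXs : X ≤ (D₁ + D₂) * s := by
        rw [hX] at hX0 ⊢
        have : 0 ≤ D₂ * β - D₁ * s := by
          by_contra! hc
          exact absurd hX0 (not_le.2 (mul_neg_of_pos_of_neg m_pos hc))
        calc m * (D₂ * β - D₁ * s) ≤ 1 * (D₂ * β - D₁ * s) := by gcongr
          _ ≤ _ := by linarith
      have h5 : β * (X * b) ≤ 1 * ((D₁ + D₂) * s * N) := by gcongr
      have h6 : 0 ≤ m * (X * b) := by positivity
      linarith
  -- Balance with `β E ≥ 0`: a negative `X` is controlled by `δ`. Five terms of size at most `δ N`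
  -- then remain, which is the origin of the constant 5.
  · have hXδ : -X ≤ δ := by nlinarith [mul_nonneg β_pos.le hE0]
    have hX1 : 0 ≤ -X := by linarith
    have hXc : -X * c ≤ δ * N := mul_le_mul hXδ c_le c_nonneg hδ0
    have hXb : -X * b ≤ δ * N := mul_le_mul hXδ b_le b_nonneg hδ0
    have h4 : (1 - s) * (-X * c) ≤ 1 * (δ * N) :=
      mul_le_mul (by linarith) hXc (mul_nonneg hX1 c_nonneg) zero_le_one
    have h5 : m * (-X * b) ≤ 1 * (δ * N) :=
      mul_le_mul hm1 hXb (mul_nonneg hX1 b_nonneg) zero_le_one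
    have h6 : β * (X * b) ≤ 0 := by
      have : 0 ≤ β * (-X * b) := mul_nonneg β_pos.le (mul_nonneg (by linarith) b_nonneg)
      linarith
    linarith

end SoftmaxFlow

/-! ### Advantages and drift under the reward and feature assumptions. -/

namespace SoftmaxFlow

lemma norm_le_featureBound {Y : Type*} [Fintype Y] {D : ℕ} (φ : Y → EuclideanSpace ℝ (Fin D)) (y : Y) : ‖φ y‖ ≤ featureBound φ :=
  le_ciSup (f := fun y => ‖φ y‖) (Set.finite_range _).bddAbove y

variable {Y : Type*} [Fintype Y] [DecidableEq Y] {D : ℕ}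
  {φ : Y → EuclideanSpace ℝ (Fin D)} {r : Y → ℝ} {ystar ymed ybad : Y} {Ybad : Finset Y}

lemma RewardStructure.star_notMem (hR : RewardStructure r ystar ymed Ybad) : ystar ∉ Ybad :=
  fun h => by linarith [hR.bad_nonpos _ h, hR.star_gt_med, hR.med_pos]

lemma RewardStructure.med_notMem (hR : RewardStructure r ystar ymed Ybad) : ymed ∉ Ybad :=
  fun h => by linarith [hR.bad_nonpos _ h, hR.med_pos]

lemma RewardStructure.star_ne_med (hR : RewardStructure r ystar ymed Ybad) : ystar ≠ ymed :=
  fun h => by have := hR.star_gt_med; rw [h] at this; exact lt_irrefl _ this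

lemma RewardStructure.sum_eq {E : Type*} [AddCommMonoid E] (hR : RewardStructure r ystar ymed Ybad)
    (f : Y → E) : ∑ y, f y = f ystar + f ymed + ∑ z ∈ Ybad, f z := by
  rw [hR.cover, Finset.sum_union, Finset.sum_pair hR.star_ne_med]
  simp [hR.star_notMem, hR.med_notMem]

section Advantage

variable (hR : RewardStructure r ystar ymed Ybad) (hb : ybad ∈ Ybad)
  (θ : EuclideanSpace ℝ (Fin D))
include hR

lemma RewardStructure.sum_policy_eq :
    policy φ θ ystar + policy φ θ ymed + ∑ z ∈ Ybad, policy φ θ z = 1 := by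
  have : Nonempty Y := ⟨ystar⟩
  rw [← hR.sum_eq, sum_policy]

include hb

lemma RewardStructure.expectedReward_eq :
    expectedReward φ r θ = policy φ θ ystar * r ystar + policy φ θ ymed * r ymed
      + (∑ z ∈ Ybad, policy φ θ z) * r ybad := by
  rw [expectedReward, hR.sum_eq, Finset.sum_mul]
  congr 1
  exact Finset.sum_congr rfl fun z hz => by rw [hR.bad_const z hz ybad hb]

lemma RewardStructure.advantage_star : advantage φ r θ ystar =
    gapStar r ystar ymed * policy φ θ ymed
      + (gapStar r ystar ymed + gapBad r ymed ybad) * ∑ z ∈ Ybad, policy φ θ z := by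
  have h1 := hR.sum_policy_eq (φ := φ) θ
  rw [advantage, hR.expectedReward_eq hb, gapStar, gapBad]
  linear_combination (-r ystar) * h1

lemma RewardStructure.advantage_med : advantage φ r θ ymed =
    gapBad r ymed ybad * ∑ z ∈ Ybad, policy φ θ z - gapStar r ystar ymed * policy φ θ ystar := by
  have h1 := hR.sum_policy_eq (φ := φ) θ
  rw [advantage, hR.expectedReward_eq hb, gapStar, gapBad]
  linear_combination (-r ymed) * h1

lemma RewardStructure.advantage_bad {z : Y} (hz : z ∈ Ybad) : advantage φ r θ z =
    -((gapStar r ystar ymed + gapBad r ymed ybad) * policy φ θ ystar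
      + gapBad r ymed ybad * policy φ θ ymed) := by
  have h1 := hR.sum_policy_eq (φ := φ) θ
  rw [advantage, hR.expectedReward_eq hb, gapStar, gapBad, hR.bad_const z hz ybad hb]
  linear_combination (-r ybad) * h1

end Advantage

lemma RewardStructure.gapStar_pos (hR : RewardStructure r ystar ymed Ybad) :
    0 < gapStar r ystar ymed := sub_pos.2 hR.star_gt_med

lemma RewardStructure.med_le_gapBad (hR : RewardStructure r ystar ymed Ybad) (hb : ybad ∈ Ybad) :
    r ymed ≤ gapBad r ymed ybad := by
  have := hR.bad_nonpos _ hb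
  rw [gapBad]; linarith

lemma inner_drift_bad (hR : RewardStructure r ystar ymed Ybad) (hb : ybad ∈ Ybad)
    (hF : FeatureStructure φ ystar ymed Ybad) (θ : EuclideanSpace ℝ (Fin D)) {z : Y}
    (hz : z ∈ Ybad) : inner ℝ (φ z) (drift φ r θ) =
      policy φ θ z * ‖φ z‖ ^ 2 * -((gapStar r ystar ymed + gapBad r ymed ybad) * policy φ θ ystar
      + gapBad r ymed ybad * policy φ θ ymed) := by
  rw [drift, inner_sum, Finset.sum_eq_single z]
  · rw [real_inner_smul_right, hR.advantage_bad hb θ hz, real_inner_self_eq_norm_sq]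
    ring
  · intro y _ hy
    rw [real_inner_smul_right, hF.bad_orthogonal z hz y hy, mul_zero]
  · simp

/-- The gradient of the expected reward in terms of the three reward levels. -/
lemma exists_levels (hR : RewardStructure r ystar ymed Ybad) (hb : ybad ∈ Ybad)
    (hF : FeatureStructure φ ystar ymed Ybad) (θ : EuclideanSpace ℝ (Fin D)) :
    ∃ Q X δ E : ℝ,
      Levels (policy φ θ ystar) (policy φ θ ymed) (∑ z ∈ Ybad, policy φ θ z)
        (gapStar r ystar ymed) (gapBad r ymed ybad) (‖φ ystar‖ ^ 2) (‖φ ymed‖ ^ 2)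
        (-inner ℝ (φ ystar) (φ ymed)) Q (featureBound φ ^ 2) ∧
      X = policy φ θ ymed * (gapBad r ymed ybad * ∑ z ∈ Ybad, policy φ θ z
        - gapStar r ystar ymed * policy φ θ ystar) ∧
      δ = policy φ θ ystar * (gapStar r ystar ymed * policy φ θ ymed
        + (gapStar r ystar ymed + gapBad r ymed ybad) * ∑ z ∈ Ybad, policy φ θ z) ∧
      E = (gapStar r ystar ymed + gapBad r ymed ybad) * policy φ θ ystar
        + gapBad r ymed ybad * policy φ θ ymed ∧
      inner ℝ (φ ystar) (drift φ r θ) = δ * ‖φ ystar‖ ^ 2 - X * -inner ℝ (φ ystar) (φ ymed) ∧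
      ∑ z ∈ Ybad, policy φ θ z * inner ℝ (φ z) (drift φ r θ) = -(E * Q) ∧
      ∑ z, policy φ θ z * inner ℝ (φ z) (drift φ r θ) =
        meanDrift (policy φ θ ystar) (policy φ θ ymed) (‖φ ystar‖ ^ 2) (‖φ ymed‖ ^ 2)
          (-inner ℝ (φ ystar) (φ ymed)) Q X δ E ∧
      ‖drift φ r θ‖ ≤ featureBound φ * (δ + |X| + (∑ z ∈ Ybad, policy φ θ z) * E) := by
  have : Nonempty Y := ⟨ystar⟩
  have hπ := policy_pos φ θ
  have hD₂ : 0 < gapBad r ymed ybad := hR.med_pos.trans_le (hR.med_le_gapBad hb)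
  have hD₁ := hR.gapStar_pos
  have hbadsum : ∑ z ∈ Ybad, policy φ θ z * inner ℝ (φ z) (drift φ r θ) =
      -(((gapStar r ystar ymed + gapBad r ymed ybad) * policy φ θ ystar
        + gapBad r ymed ybad * policy φ θ ymed) * ∑ z ∈ Ybad, policy φ θ z ^ 2 * ‖φ z‖ ^ 2) := by
    rw [Finset.mul_sum, ← Finset.sum_neg_distrib]
    refine Finset.sum_congr rfl fun z hz => ?_
    rw [inner_drift_bad hR hb hF θ hz]
    ring
  have hstar : inner ℝ (φ ystar) (drift φ r θ) =
      policy φ θ ystar * (gapStar r ystar ymed * policy φ θ ymed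
        + (gapStar r ystar ymed + gapBad r ymed ybad) * ∑ z ∈ Ybad, policy φ θ z)
        * ‖φ ystar‖ ^ 2 - policy φ θ ymed * (gapBad r ymed ybad * ∑ z ∈ Ybad, policy φ θ z
        - gapStar r ystar ymed * policy φ θ ystar) * -inner ℝ (φ ystar) (φ ymed) := by
    rw [drift, inner_sum, hR.sum_eq, Finset.sum_eq_zero]
    · rw [real_inner_smul_right, real_inner_smul_right, hR.advantage_star hb, hR.advantage_med hb,
        real_inner_self_eq_norm_sq]
      ring
    · intro z hz
      rw [real_inner_smul_right, real_inner_comm, hF.bad_orthogonal z hz ystar, mul_zero]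
      rintro rfl; exact hR.star_notMem hz
  have hmed : inner ℝ (φ ymed) (drift φ r θ) =
      policy φ θ ymed * (gapBad r ymed ybad * ∑ z ∈ Ybad, policy φ θ z
        - gapStar r ystar ymed * policy φ θ ystar) * ‖φ ymed‖ ^ 2 -
      policy φ θ ystar * (gapStar r ystar ymed * policy φ θ ymed
        + (gapStar r ystar ymed + gapBad r ymed ybad) * ∑ z ∈ Ybad, policy φ θ z)
        * -inner ℝ (φ ystar) (φ ymed) := by
    rw [drift, inner_sum, hR.sum_eq, Finset.sum_eq_zero]
    · rw [real_inner_smul_right, real_inner_smul_right, hR.advantage_star hb, hR.advantage_med hb,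
        real_inner_self_eq_norm_sq, real_inner_comm]
      ring
    · intro z hz
      rw [real_inner_smul_right, real_inner_comm, hF.bad_orthogonal z hz ymed, mul_zero]
      rintro rfl; exact hR.med_notMem hz
  have hB0 : 0 ≤ featureBound φ := (norm_nonneg _).trans (norm_le_featureBound φ ystar)
  have hsq : ∀ y, ‖φ y‖ ^ 2 ≤ featureBound φ ^ 2 := fun y =>
    pow_le_pow_left₀ (norm_nonneg _) (norm_le_featureBound φ y) 2
  refine ⟨∑ z ∈ Ybad, policy φ θ z ^ 2 * ‖φ z‖ ^ 2, _, _, _, ?_, rfl, rfl, rfl, hstar, hbadsum,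
    ?_, ?_⟩
  · refine ⟨hπ _, hπ _, Finset.sum_pos (fun z _ => hπ z) ⟨_, hb⟩, hR.sum_policy_eq θ, hD₁, hD₂,
      by positivity, by positivity, by linarith [hF.inner_neg], hsq _, hsq _, ?_, ?_, ?_⟩
    · calc -inner ℝ (φ ystar) (φ ymed) ≤ |inner ℝ (φ ystar) (φ ymed)| := neg_le_abs _
        _ ≤ ‖φ ystar‖ * ‖φ ymed‖ := abs_real_inner_le_norm _ _
        _ ≤ featureBound φ * featureBound φ :=
          mul_le_mul (norm_le_featureBound φ _) (norm_le_featureBound φ _) (norm_nonneg _) hB0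
        _ = _ := (sq _).symm
    · exact Finset.sum_nonneg fun z _ => by positivity
    -- Together with `‖φ z‖ ≤ ‖φ ymed‖` this treats the bad set as a single outcome of mass `β`
    -- whose feature is no longer than that of the medium outcome.
    · have h1 : ∑ z ∈ Ybad, policy φ θ z ^ 2 ≤ (∑ z ∈ Ybad, policy φ θ z) ^ 2 :=
        Finset.sum_sq_le_sq_sum_of_nonneg fun z _ => (hπ z).le
      calc ∑ z ∈ Ybad, policy φ θ z ^ 2 * ‖φ z‖ ^ 2
          ≤ ∑ z ∈ Ybad, policy φ θ z ^ 2 * ‖φ ymed‖ ^ 2 := by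
            refine Finset.sum_le_sum fun z hz => ?_
            have := hF.bad_norm_le z hz
            gcongr
        _ = ‖φ ymed‖ ^ 2 * ∑ z ∈ Ybad, policy φ θ z ^ 2 := by rw [← Finset.sum_mul, mul_comm]
        _ ≤ _ := by gcongr
  · rw [hR.sum_eq, hbadsum, hstar, hmed, meanDrift]
    ring
  · have habs : ∀ y, ‖(policy φ θ y * advantage φ r θ y) • φ y‖ ≤
        featureBound φ * |policy φ θ y * advantage φ r θ y| := fun y => by
      rw [norm_smul, Real.norm_eq_abs, mul_comm]
      gcongr
      exact norm_le_featureBound φ y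
    calc ‖drift φ r θ‖ ≤ ∑ y, featureBound φ * |policy φ θ y * advantage φ r θ y| :=
          norm_sum_le_of_le _ fun y _ => habs y
      _ = featureBound φ * ∑ y, |policy φ θ y * advantage φ r θ y| := by rw [Finset.mul_sum]
      _ = _ := by
        rw [hR.sum_eq, hR.advantage_star hb, hR.advantage_med hb, Finset.sum_mul]
        congr 2
        · rw [abs_of_nonneg]
          have h1 := hπ ystar
          have h2 := hπ ymed
          have h3 : 0 ≤ ∑ z ∈ Ybad, policy φ θ z := Finset.sum_nonneg fun z _ => (hπ z).le
          positivity
        · refine Finset.sum_congr rfl fun z hz => ?_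
          have h1 := hπ ystar
          have h2 := hπ ymed
          rw [hR.advantage_bad hb θ hz, mul_neg, abs_neg, abs_of_nonneg]
          have h3 := hπ z
          positivity

end SoftmaxFlow

/-! ### The two phases of the flow for the ground truth reward. -/

namespace SoftmaxFlow

section LogDerivative

variable {Y : Type*} [Fintype Y] {D : ℕ} {φ : Y → EuclideanSpace ℝ (Fin D)} {r : Y → ℝ}
  {θ₀ : EuclideanSpace ℝ (Fin D)} {ϑ : ℝ → EuclideanSpace ℝ (Fin D)}

lemma IsGradientFlow.hasDerivWithinAt_log_policy [Nonempty Y] (h : IsGradientFlow φ r θ₀ ϑ) (y : Y)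
    {t : ℝ} (ht : 0 ≤ t) :
    HasDerivWithinAt (fun t => Real.log (policy φ (ϑ t) y))
      (inner ℝ (φ y) (drift φ r (ϑ t)) -
        ∑ z, policy φ (ϑ t) z * inner ℝ (φ z) (drift φ r (ϑ t))) (Set.Ici 0) t := by
  have hpos := (policy_pos φ (ϑ t) y).ne'
  refine ((h.hasDerivWithinAt_policy y ht).log hpos).congr_deriv ?_
  exact mul_div_cancel_left₀ _ hpos

lemma IsGradientFlow.hasDerivWithinAt_log_sum_policy [Nonempty Y] (h : IsGradientFlow φ r θ₀ ϑ)
    {S : Finset Y} (hS : S.Nonempty) {t : ℝ} (ht : 0 ≤ t) :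
    HasDerivWithinAt (fun t => Real.log (∑ z ∈ S, policy φ (ϑ t) z))
      ((∑ z ∈ S, policy φ (ϑ t) z * inner ℝ (φ z) (drift φ r (ϑ t))) /
          (∑ z ∈ S, policy φ (ϑ t) z) -
        ∑ z, policy φ (ϑ t) z * inner ℝ (φ z) (drift φ r (ϑ t))) (Set.Ici 0) t := by
  have hpos : 0 < ∑ z ∈ S, policy φ (ϑ t) z := Finset.sum_pos (fun z _ => policy_pos φ (ϑ t) z) hS
  refine ((HasDerivWithinAt.fun_sum fun z _ => h.hasDerivWithinAt_policy z ht).log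
    hpos.ne').congr_deriv ?_
  simp only [mul_sub, Finset.sum_sub_distrib, ← Finset.sum_mul]
  field_simp

lemma IsGradientFlow.continuousOn_policy [Nonempty Y] (h : IsGradientFlow φ r θ₀ ϑ) (y : Y) :
    ContinuousOn (fun t => policy φ (ϑ t) y) (Set.Ici 0) :=
  fun _ ht => (h.hasDerivWithinAt_policy y ht).continuousWithinAt

end LogDerivative

variable {Y : Type*} [Fintype Y] [DecidableEq Y] {D : ℕ}
  {φ : Y → EuclideanSpace ℝ (Fin D)} {r : Y → ℝ} {ystar ymed ybad : Y} {Ybad : Finset Y}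
  {θ₀ : EuclideanSpace ℝ (Fin D)} {ϑ : ℝ → EuclideanSpace ℝ (Fin D)}

/-- Before the expected reward exceeds the medium reward, the probability of the best outcome
drops: along with it, the bad outcomes lose their mass to the medium one. -/
lemma IsGradientFlow.exists_star_small (h : IsGradientFlow φ r θ₀ ϑ)
    (hR : RewardStructure r ystar ymed Ybad) (hb : ybad ∈ Ybad)
    (hF : FeatureStructure φ ystar ymed Ybad) {w M γ T : ℝ} (hw : 0 < w) (hM : 0 < M) (hM1 : M ≤ 1)
    (hMN : M * featureBound φ ^ 2 * (gapStar r ystar ymed + gapBad r ymed ybad) ≤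
      ‖φ ymed‖ ^ 2 / 40) (hw1 : w ^ 7 ≤ 0.1)
    (hw2 : w ^ 7 ≤ 0.05 * (gapStar r ystar ymed + gapBad r ymed ybad))
    (hD₁ : gapStar r ystar ymed ≤ 1) (hs0 : policy φ θ₀ ystar = M * w ^ 13)
    (hβ2 : ∑ z ∈ Ybad, policy φ θ₀ z ≤ 0.1) (hγ0 : 0 ≤ γ) (hγ : γ ≤ 2 / 7) (hT : 0 ≤ T)
    (hV : r ymed ≤ expectedReward φ r (ϑ T)) :
    ∃ t₁ ∈ Set.Icc 0 T, (∀ t, 0 ≤ t → t < t₁ → expectedReward φ r (ϑ t) < r ymed) ∧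
      policy φ (ϑ t₁) ystar ≤ policy φ θ₀ ystar ∧
      policy φ (ϑ t₁) ystar ≤ policy φ θ₀ ystar *
        (w ^ 7 / gapBad r ymed ybad / ∑ z ∈ Ybad, policy φ θ₀ z) ^ γ := by
  have hne : Nonempty Y := ⟨ystar⟩
  have hD₂ : 0 < gapBad r ymed ybad := hR.med_pos.trans_le (hR.med_le_gapBad hb)
  set s : ℝ → ℝ := fun t => policy φ (ϑ t) ystar with hs
  set β : ℝ → ℝ := fun t => ∑ z ∈ Ybad, policy φ (ϑ t) z with hβ
  have hs_pos : ∀ t, 0 < s t := fun t => policy_pos φ (ϑ t) ystar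
  have hβ_pos : ∀ t, 0 < β t := fun t => Finset.sum_pos (fun z _ => policy_pos φ _ z) ⟨_, hb⟩
  have hs_init : s 0 = M * w ^ 13 := by simp only [hs, h.initial, hs0]
  have hβ_init : β 0 = ∑ z ∈ Ybad, policy φ θ₀ z := by simp only [hβ, h.initial]
  have hs_cont : ContinuousOn s (Set.Ici 0) := h.continuousOn_policy ystar
  have hβ_cont : ContinuousOn β (Set.Ici 0) :=
    continuousOn_finsetSum _ fun z _ => h.continuousOn_policy z
  -- Bootstrap: the thresholds `2 M w ^ 13` and `0.11` lie strictly above the initial bounds `M w ^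
  -- 13` and `0.1`, so at the first exit only the first alternative can occur.
  set bad : ℝ → Prop := fun t =>
    gapBad r ymed ybad * β t ≤ w ^ 7 ∨ 2 * (M * w ^ 13) ≤ s t ∨ 0.11 ≤ β t with hbad
  have hVlt : ∀ t, ¬ bad t → expectedReward φ r (ϑ t) < r ymed := by
    intro t ht
    simp only [hbad, not_or, not_le] at ht
    obtain ⟨Q, X, δ, E, hL, hX, hδ, hE, -⟩ := exists_levels hR hb hF (ϑ t)
    have := (hL.med_dominates hX hδ hw hM1 hMN hw1 hw2 hD₁ ht.1.le ht.2.2.le ht.2.1.le).2.2.2.2.2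
    rw [← hR.advantage_med hb, advantage] at this
    linarith
  set S : Set ℝ := Set.Icc 0 T ∩ {t | bad t} with hS
  have hSc : IsCompact S := by
    have hsub : Set.Icc (0 : ℝ) T ⊆ Set.Ici 0 := fun x hx => hx.1
    have e : S = (Set.Icc 0 T ∩ (fun t => gapBad r ymed ybad * β t) ⁻¹' Set.Iic (w ^ 7)) ∪
        ((Set.Icc 0 T ∩ s ⁻¹' Set.Ici (2 * (M * w ^ 13))) ∪
          (Set.Icc 0 T ∩ β ⁻¹' Set.Ici 0.11)) := by
      ext t
      simp only [hS, hbad, Set.mem_inter_iff, Set.mem_ofPred_eq, Set.mem_union, Set.mem_preimage,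
        Set.mem_Iic, Set.mem_Ici]
      tauto
    rw [e]
    refine (isCompact_Icc (a := (0 : ℝ)) (b := T)).of_isClosed_subset (IsClosed.union ?_ (IsClosed.union ?_ ?_)) ?_
    · exact (continuousOn_const.mul (hβ_cont.mono hsub)).preimage_isClosed_of_isClosed
        isClosed_Icc isClosed_Iic
    · exact (hs_cont.mono hsub).preimage_isClosed_of_isClosed isClosed_Icc isClosed_Ici
    · exact (hβ_cont.mono hsub).preimage_isClosed_of_isClosed isClosed_Icc isClosed_Ici
    · rintro t (⟨h, -⟩ | ⟨h, -⟩ | ⟨h, -⟩) <;> exact h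
  -- Outside `bad` the medium outcome has positive advantage, so a reward of at least `r ymed` at
  -- time `T` forces an exit by then.
  have hSne : S.Nonempty := ⟨T, ⟨hT, le_rfl⟩, by
    by_contra hc
    exact absurd hV (not_le.2 (hVlt T hc))⟩
  have ht₁S : sInf S ∈ S := hSc.sInf_mem hSne
  set t₁ := sInf S with ht₁
  have hgood : ∀ t, 0 ≤ t → t < t₁ → ¬ bad t := fun t h0 hlt hc =>
    absurd (csInf_le hSc.bddBelow ⟨⟨h0, hlt.le.trans ht₁S.1.2⟩, hc⟩) (not_le.2 hlt)
  have key : ∀ t, 0 < t → t < t₁ →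
      (inner ℝ (φ ystar) (drift φ r (ϑ t)) -
        ∑ z, policy φ (ϑ t) z * inner ℝ (φ z) (drift φ r (ϑ t)) ≤ 0) ∧
      ((∑ z ∈ Ybad, policy φ (ϑ t) z * inner ℝ (φ z) (drift φ r (ϑ t))) / (β t) -
        ∑ z, policy φ (ϑ t) z * inner ℝ (φ z) (drift φ r (ϑ t)) ≤ 0) ∧
      (inner ℝ (φ ystar) (drift φ r (ϑ t)) -
        ∑ z, policy φ (ϑ t) z * inner ℝ (φ z) (drift φ r (ϑ t))) -
      γ * ((∑ z ∈ Ybad, policy φ (ϑ t) z * inner ℝ (φ z) (drift φ r (ϑ t))) / (β t) -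
        ∑ z, policy φ (ϑ t) z * inner ℝ (φ z) (drift φ r (ϑ t))) ≤ 0 := by
    intro t h0 hlt
    have ht := hgood t h0.le hlt
    simp only [hbad, not_or, not_le] at ht
    obtain ⟨Q, X, δ, E, hL, hX, hδ, hE, h1, h2, h3, -⟩ := exists_levels hR hb hF (ϑ t)
    obtain ⟨hX0, hs3, hsN, hδN, hm, -⟩ :=
      hL.med_dominates hX hδ hw hM1 hMN hw1 hw2 hD₁ ht.1.le ht.2.2.le ht.2.1.le
    have hbal := hL.balance hX hδ hE
    have h4 := hL.log_star_le hδ hE hbal hX0 hs3 hδN hm ht.2.2.le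
    obtain ⟨h5, h6⟩ := hL.log_bad_bounds hδ hE hbal hX0 hs3 hsN hδN hm
    have hXb : 0 ≤ X * ‖φ ymed‖ ^ 2 := by positivity
    rw [h1, h2, h3, neg_div]
    refine ⟨by linarith, h6, ?_⟩
    have h7 := mul_le_mul_of_nonneg_left h5 hγ0
    -- Here `2.03 * 2 / 7 = 0.58 < 0.7`: the decay of `log s` beats `γ` times that of `log β`.
    have h8 : γ * (X * ‖φ ymed‖ ^ 2) ≤ 2 / 7 * (X * ‖φ ymed‖ ^ 2) := by gcongr
    linarith
  have hlogs := fun t (ht : 0 ≤ t) => h.hasDerivWithinAt_log_policy ystar ht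
  have hlogβ := fun t (ht : 0 ≤ t) => h.hasDerivWithinAt_log_sum_policy ⟨ybad, hb⟩ ht
  have i1 := le_of_hasDerivWithinAt_nonpos le_rfl ht₁S.1.1 hlogs
    fun t h0 hlt => (key t h0 hlt).1
  have i2 := le_of_hasDerivWithinAt_nonpos le_rfl ht₁S.1.1 hlogβ
    fun t h0 hlt => (key t h0 hlt).2.1
  have i3 := le_of_hasDerivWithinAt_nonpos le_rfl ht₁S.1.1
    (fun t ht => (hlogs t ht).sub ((hlogβ t ht).const_mul γ))
    fun t h0 hlt => (key t h0 hlt).2.2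
  have j1 : s t₁ ≤ s 0 := (Real.log_le_log_iff (hs_pos _) (hs_pos _)).1 i1
  have j2 : β t₁ ≤ β 0 := (Real.log_le_log_iff (hβ_pos _) (hβ_pos _)).1 i2
  have j3 : s t₁ ≤ s 0 * (β t₁ / β 0) ^ γ := by
    have hq : 0 < β t₁ / β 0 := div_pos (hβ_pos _) (hβ_pos _)
    rw [← Real.log_le_log_iff (hs_pos _) (mul_pos (hs_pos _) (Real.rpow_pos_of_pos hq _)),
      Real.log_mul (hs_pos _).ne' (Real.rpow_pos_of_pos hq _).ne', Real.log_rpow hq,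
      Real.log_div (hβ_pos _).ne' (hβ_pos _).ne']
    have : Real.log (s t₁) - γ * Real.log (β t₁) ≤ Real.log (s 0) - γ * Real.log (β 0) := i3
    linarith
  have hs0pos : 0 < M * w ^ 13 := by positivity
  -- Both `s` and `β` have decreased up to `t₁`, which excludes the other two exits.
  have hexit : gapBad r ymed ybad * β t₁ ≤ w ^ 7 := by
    rcases ht₁S.2 with h' | h' | h'
    · exact h'
    · linarith
    · rw [hβ_init] at j2; linarith
  rw [← hs_init.trans hs0.symm, ← hβ_init]
  refine ⟨t₁, ht₁S.1, fun t h0 hlt => hVlt t (hgood t h0 hlt), j1, j3.trans ?_⟩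
  have := hβ_pos 0
  have := hβ_pos t₁
  have := hs_pos 0
  gcongr
  rw [le_div_iff₀ hD₂]; linarith

/-- The probability of the best outcome grows at most like the solution of `s' = κ s²`. -/
lemma IsGradientFlow.inv_star_growth (h : IsGradientFlow φ r θ₀ ϑ)
    (hR : RewardStructure r ystar ymed Ybad) (hb : ybad ∈ Ybad)
    (hF : FeatureStructure φ ystar ymed Ybad)
    (hβ : ∑ z ∈ Ybad, policy φ θ₀ z ≤ 0.1) {t₁ t : ℝ} (ht₁ : 0 ≤ t₁) (ht : t₁ ≤ t) :
    (policy φ (ϑ t₁) ystar)⁻¹ - 5 * featureBound φ ^ 2 *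
      (gapStar r ystar ymed + gapBad r ymed ybad) * (t - t₁) ≤ (policy φ (ϑ t) ystar)⁻¹ := by
  have hne : Nonempty Y := ⟨ystar⟩
  have hD₂ : 0 < gapBad r ymed ybad := hR.med_pos.trans_le (hR.med_le_gapBad hb)
  have hD₁ := hR.gapStar_pos
  set κ := 5 * featureBound φ ^ 2 * (gapStar r ystar ymed + gapBad r ymed ybad) with hκ
  have hd : ∀ t, 0 ≤ t → HasDerivWithinAt
      (fun t => -(policy φ (ϑ t) ystar)⁻¹ - κ * t) ((inner ℝ (φ ystar) (drift φ r (ϑ t)) -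
        ∑ z, policy φ (ϑ t) z * inner ℝ (φ z) (drift φ r (ϑ t))) / policy φ (ϑ t) ystar - κ)
        (Set.Ici 0) t := fun t ht => by
    have hpos := (policy_pos φ (ϑ t) ystar).ne'
    refine (((h.hasDerivWithinAt_policy ystar ht).fun_inv hpos).neg.sub
      ((hasDerivWithinAt_id t _).const_mul κ)).congr_deriv ?_
    field_simp
  have := le_of_hasDerivWithinAt_nonpos ht₁ ht hd fun t h0 _ => ?_
  · linarith
  · have hpos := policy_pos φ (ϑ t) ystar
    obtain ⟨Q, X, δ, E, hL, hX, hδ, hE, h1, h2, h3, -⟩ := exists_levels hR hb hF (ϑ t)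
    -- The medium advantage never exceeds its initial value, which is at most `0.1 D₂ < D₂ / 4`; so
    -- the growth estimate is valid at all times.
    have hmono := h.expectedReward_mono le_rfl (ht₁.trans h0.le)
    have hA0 := hR.advantage_med hb θ₀ (φ := φ)
    have hAt := hR.advantage_med hb (ϑ t) (φ := φ)
    rw [advantage] at hA0 hAt
    rw [h.initial] at hmono
    have h4 : gapBad r ymed ybad * ∑ z ∈ Ybad, policy φ θ₀ z ≤ gapBad r ymed ybad * 0.1 := by
      gcongr
    have h5 : 0 < gapStar r ystar ymed * policy φ θ₀ ystar := mul_pos hD₁ (policy_pos φ _ _)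
    have h6 := hL.log_star_growth hX hδ hE (by linarith)
    rw [sub_nonpos, div_le_iff₀ hpos, h1, h3]
    linarith

/-- Reaching the reward `r(med) + x` takes a time of order `1 / p`, if the probability of the best
outcome was `p` at a time before which the expected reward is below `r(med)`. -/
lemma IsGradientFlow.le_time_of_star_small (h : IsGradientFlow φ r θ₀ ϑ)
    (hR : RewardStructure r ystar ymed Ybad) (hb : ybad ∈ Ybad)
    (hF : FeatureStructure φ ystar ymed Ybad) (hφ : 0 < featureBound φ)
    (hβ : ∑ z ∈ Ybad, policy φ θ₀ z ≤ 0.1)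
    (hD : gapStar r ystar ymed + gapBad r ymed ybad ≤ 2) {t₁ T x : ℝ} (ht₁ : t₁ ∈ Set.Icc 0 T)
    (hlow : ∀ t, 0 ≤ t → t < t₁ → expectedReward φ r (ϑ t) < r ymed)
    (hinit : expectedReward φ r θ₀ < r ymed)
    (hp : policy φ (ϑ t₁) ystar ≤ 0.1) (hx : 0 < x)
    (hV : r ymed + x ≤ expectedReward φ r (ϑ T)) :
    (1 - Real.exp (-2 * x)) / (10 * featureBound φ ^ 2 *
      (gapStar r ystar ymed + gapBad r ymed ybad) * policy φ (ϑ t₁) ystar) ≤ T - t₁ := by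
  have hne : Nonempty Y := ⟨ystar⟩
  have hD₂ : 0 < gapBad r ymed ybad := hR.med_pos.trans_le (hR.med_le_gapBad hb)
  have hD₁0 := hR.gapStar_pos
  set Δ := gapStar r ystar ymed + gapBad r ymed ybad with hΔ
  have hΔ0 : 0 < Δ := by positivity
  set p := policy φ (ϑ t₁) ystar with hpdef
  have hp0 : 0 < p := policy_pos φ _ _
  set N := featureBound φ ^ 2 with hN
  have hN0 : 0 < N := by positivity
  by_contra! hc
  have hden : 0 < 10 * N * Δ * p := by positivity
  rw [lt_div_iff₀ hden] at hc
  have he1 : 1 - Real.exp (-2 * x) ≤ 1 := by linarith [Real.exp_pos (-2 * x)]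
  have he2 : 1 - Real.exp (-2 * x) ≤ 2 * x := by linarith [Real.add_one_le_exp (-2 * x)]
  -- If the claim fails, `T - t₁ < 1 / (10 N Δ p)`, and over such a time `1 / s` loses at most half
  -- of `1 / p`.
  have hsmall : ∀ t, t₁ ≤ t → t ≤ T → policy φ (ϑ t) ystar ≤ 2 * p := by
    intro t h1 h2
    have hg := h.inv_star_growth hR hb hF hβ ht₁.1 h1
    have h3 : 5 * N * Δ * (t - t₁) ≤ p⁻¹ / 2 := by
      have e : p⁻¹ / 2 = 1 / (2 * p) := by field_simp
      rw [e, le_div_iff₀ (by positivity)]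
      calc 5 * N * Δ * (t - t₁) * (2 * p) ≤ 5 * N * Δ * (T - t₁) * (2 * p) := by gcongr
        _ = (T - t₁) * (10 * N * Δ * p) := by ring
        _ ≤ 1 := by linarith
    have h4 : (2 * p)⁻¹ ≤ (policy φ (ϑ t) ystar)⁻¹ := by
      have : (2 * p)⁻¹ = p⁻¹ - p⁻¹ / 2 := by field_simp; norm_num
      rw [this]; linarith
    exact (inv_le_inv₀ (by positivity) (policy_pos φ _ _)).1 h4
  have hVcont : ContinuousOn (fun t => expectedReward φ r (ϑ t)) (Set.Icc 0 T) := fun t ht =>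
    (h.hasDerivWithinAt_expectedReward ht.1).continuousWithinAt.mono fun x hx => hx.1
  obtain ⟨t₂, ht₂, hVt₂⟩ := intermediate_value_Icc (ht₁.1.trans ht₁.2) hVcont
    (show r ymed ∈ Set.Icc _ _ from ⟨by simpa only [h.initial] using hinit.le, by linarith⟩)
  simp only at hVt₂
  have ht₁₂ : t₁ ≤ t₂ := by
    by_contra! hlt
    have := hlow t₂ ht₂.1 hlt
    linarith
  -- The square of `4 B Δ p`, with `B` the feature bound. After `t₂` the medium advantage is
  -- nonpositive, so `δ + |X| + β E = 2 δ ≤ 4 p Δ`, which bounds the drift. The total gain is then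
  -- at most `0.64 x`, short of `x`.
  set C := 16 * N * Δ ^ 2 * p ^ 2 with hC
  have hgain := le_of_hasDerivWithinAt_nonpos ht₂.1 ht₂.2
    (fun t ht => (h.hasDerivWithinAt_expectedReward ht).sub
      ((hasDerivWithinAt_id t _).const_mul C)) fun t h0 hlt => ?_
  · have e1 : C * (T - t₂) ≤ C * (T - t₁) := by gcongr
    have e2 : C * (T - t₁) = 1.6 * (Δ * p) * ((T - t₁) * (10 * N * Δ * p)) := by rw [hC]; ring
    have e3 : Δ * p ≤ 2 * 0.1 := by gcongr
    have e4 : 1.6 * (Δ * p) * ((T - t₁) * (10 * N * Δ * p)) ≤ 1.6 * (Δ * p) * (2 * x) :=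
      mul_le_mul_of_nonneg_left (by linarith) (by positivity)
    have e5 : 1.6 * (Δ * p) * (2 * x) ≤ 1.6 * (2 * 0.1) * (2 * x) := by gcongr
    simp only [id, Pi.sub_apply] at hgain
    linarith
  · obtain ⟨Q, X, δ, E, hL, hX, hδ, hE, h1, h2, h3, h4⟩ := exists_levels hR hb hF (ϑ t)
    have hbal := hL.balance hX hδ hE
    have hδ0 := hL.δ_nonneg hδ
    have hmono := h.expectedReward_mono ht₂.1 h0.le
    have hA := hR.advantage_med hb (ϑ t) (φ := φ)
    rw [advantage] at hA
    have hX0 : X ≤ 0 := by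
      rw [hX]
      exact mul_nonpos_of_nonneg_of_nonpos hL.m_pos.le (by linarith)
    rw [abs_of_nonpos hX0, hbal] at h4
    have hs := hsmall t (ht₁₂.trans h0.le) hlt.le
    have hδs : δ ≤ 2 * p * Δ := by
      have hβm : gapStar r ystar ymed * policy φ (ϑ t) ymed + Δ * ∑ z ∈ Ybad, policy φ (ϑ t) z
          ≤ Δ := by
        have e1 := hL.sum_eq
        have e2 := hL.s_pos
        have e3 := hL.m_pos
        have e4 : gapStar r ystar ymed * policy φ (ϑ t) ymed ≤ Δ * policy φ (ϑ t) ymed := by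
          gcongr; linarith
        have e5 : Δ * (policy φ (ϑ t) ymed + ∑ z ∈ Ybad, policy φ (ϑ t) z) ≤ Δ * 1 := by
          gcongr; linarith
        linarith
      have e1 := hL.m_pos
      have e2 := hL.β_pos
      rw [hδ]
      gcongr
    have hle : ‖drift φ r (ϑ t)‖ ≤ featureBound φ * (2 * (2 * p * Δ)) :=
      h4.trans (by gcongr; linarith)
    have : ‖drift φ r (ϑ t)‖ ^ 2 ≤ (featureBound φ * (2 * (2 * p * Δ))) ^ 2 := by gcongr
    have e : (featureBound φ * (2 * (2 * p * Δ))) ^ 2 = C := by rw [hC, hN]; ring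
    simp only [mul_one]
    linarith

end SoftmaxFlow

/-! ### Rewards with two values. -/

namespace SoftmaxFlow

section TwoValued

variable {Y : Type*} [Fintype Y] {D : ℕ} {φ : Y → EuclideanSpace ℝ (Fin D)} {r : Y → ℝ}
  {ystar : Y} {v R : ℝ}

lemma expectedReward_of_two_valued (hstar : r ystar = v + R) (hr : ∀ y, y ≠ ystar → r y = v)
    (θ : EuclideanSpace ℝ (Fin D)) : expectedReward φ r θ = v + R * policy φ θ ystar := by
  classical
  have hne : Nonempty Y := ⟨ystar⟩
  have h1 : ∀ y, policy φ θ y * r y = v * policy φ θ y + if y = ystar then R * policy φ θ y else 0 :=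
    fun y => by
      split_ifs with h
      · rw [h, hstar]; ring
      · rw [hr y h]; ring
  simp only [expectedReward, h1, Finset.sum_add_distrib, ← Finset.mul_sum, sum_policy,
    Finset.sum_ite_eq', Finset.mem_univ, if_true, mul_one]

/-- Every other outcome has nonpositive advantage and a feature at nonpositive inner product with `φ
ystar`, so its term is nonnegative and can be dropped. -/
lemma le_inner_drift_of_two_valued (hstar : r ystar = v + R) (hr : ∀ y, y ≠ ystar → r y = v)
    (hR : 0 ≤ R) (hφ : ∀ y, y ≠ ystar → inner ℝ (φ ystar) (φ y) ≤ 0)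
    (θ : EuclideanSpace ℝ (Fin D)) :
    R * (policy φ θ ystar * (1 - policy φ θ ystar)) * ‖φ ystar‖ ^ 2 ≤
      inner ℝ (φ ystar) (drift φ r θ) := by
  have hne : Nonempty Y := ⟨ystar⟩
  have hV := expectedReward_of_two_valued (φ := φ) hstar hr θ
  have hterm : R * (policy φ θ ystar * (1 - policy φ θ ystar)) * ‖φ ystar‖ ^ 2 =
      inner ℝ (φ ystar) ((policy φ θ ystar * advantage φ r θ ystar) • φ ystar) := by
    rw [real_inner_smul_right, real_inner_self_eq_norm_sq, advantage, hV, hstar]; ring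
  rw [hterm, drift, inner_sum]
  refine Finset.single_le_sum
    (f := fun y => inner ℝ (φ ystar) ((policy φ θ y * advantage φ r θ y) • φ y))
    (fun y _ => ?_) (Finset.mem_univ ystar)
  have h1 : policy φ θ ystar ≤ 1 := by
    rw [← sum_policy φ θ]
    exact Finset.single_le_sum (fun y _ => (policy_pos φ θ y).le) (Finset.mem_univ ystar)
  have hs := policy_pos φ θ ystar
  by_cases hy : y = ystar
  · have h2 : 0 ≤ 1 - policy φ θ ystar := by linarith
    rw [hy, ← hterm]
    positivity
  · have h2 : policy φ θ y * advantage φ r θ y = -(policy φ θ y * (R * policy φ θ ystar)) := by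
      rw [advantage, hV, hr y hy]; ring
    rw [real_inner_smul_right, h2]
    exact mul_nonneg_of_nonpos_of_nonpos
      (neg_nonpos.2 (mul_nonneg (policy_pos φ θ y).le (by positivity))) (hφ y hy)

/-- With a single best outcome and all other rewards equal, the gradient flow reaches probability
`1 - η` of the best outcome in time at most `(R η² ‖φ(star)‖² s₀)⁻¹`. -/
lemma IsGradientFlow.exists_star_large {θ₀ : EuclideanSpace ℝ (Fin D)}
    {ϑ : ℝ → EuclideanSpace ℝ (Fin D)} (h : IsGradientFlow φ r θ₀ ϑ)
    (hstar : r ystar = v + R) (hr : ∀ y, y ≠ ystar → r y = v)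
    (hR : 0 < R) (hφ : ∀ y, y ≠ ystar → inner ℝ (φ ystar) (φ y) ≤ 0) (hφ0 : φ ystar ≠ 0)
    {η : ℝ} (hη : 0 < η) :
    ∃ t ∈ Set.Icc 0 (R * η ^ 2 * ‖φ ystar‖ ^ 2 * policy φ θ₀ ystar)⁻¹,
      1 - η ≤ policy φ (ϑ t) ystar := by
  have hne : Nonempty Y := ⟨ystar⟩
  have hs := fun t => policy_pos φ (ϑ t) ystar
  have hs0 := policy_pos φ θ₀ ystar
  have ha : 0 < ‖φ ystar‖ := norm_pos_iff.2 hφ0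
  by_contra! hc
  set κ := R * η ^ 2 * ‖φ ystar‖ ^ 2 with hκ
  have hκ0 : 0 < κ := by positivity
  have hT : 0 ≤ (κ * policy φ θ₀ ystar)⁻¹ := by positivity
  -- Since `V = v + R s`, the identity `V' = ‖drift‖²` reads `s' = ‖drift‖² / R`. While `s < 1 - η`
  -- this is at least `κ s ^ 2`, so `1 / s + κ t` is nonincreasing and `1 / s` would no longer be
  -- positive at time `1 / (κ s₀)`.
  have hd : ∀ t, 0 ≤ t → HasDerivWithinAt (fun t => policy φ (ϑ t) ystar)
      (‖drift φ r (ϑ t)‖ ^ 2 / R) (Set.Ici 0) t := fun t ht => by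
    have := ((h.hasDerivWithinAt_expectedReward ht).sub_const v).div_const R
    refine this.congr_of_mem (fun x _ => ?_) ht
    rw [expectedReward_of_two_valued hstar hr]
    field_simp
    ring
  have hd' := fun t (ht : 0 ≤ t) => ((hd t ht).fun_inv (hs t).ne').fun_add
    ((hasDerivWithinAt_id t _).const_mul κ)
  have hle := le_of_hasDerivWithinAt_nonpos le_rfl hT hd' fun t h0 hlt => ?_
  · simp only [id, mul_zero, add_zero, h.initial] at hle
    have e : κ * (κ * policy φ θ₀ ystar)⁻¹ = (policy φ θ₀ ystar)⁻¹ := by field_simp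
    rw [e] at hle
    have := inv_pos.2 (hs (κ * policy φ θ₀ ystar)⁻¹)
    linarith
  · have hst := hs t
    have h1 := le_inner_drift_of_two_valued hstar hr hR.le hφ (ϑ t)
    have h2 := h1.trans (real_inner_le_norm _ _)
    have h3 : η ≤ 1 - policy φ (ϑ t) ystar := by linarith [hc t ⟨h0.le, hlt.le⟩]
    have h4 : R * (policy φ (ϑ t) ystar * η) * ‖φ ystar‖ ≤ ‖drift φ r (ϑ t)‖ := by
      refine le_of_mul_le_mul_left (le_trans ?_ h2) ha
      calc ‖φ ystar‖ * (R * (policy φ (ϑ t) ystar * η) * ‖φ ystar‖)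
          = R * (policy φ (ϑ t) ystar * η) * ‖φ ystar‖ ^ 2 := by ring
        _ ≤ _ := by gcongr
    have h5 : (R * (policy φ (ϑ t) ystar * η) * ‖φ ystar‖) ^ 2 ≤ ‖drift φ r (ϑ t)‖ ^ 2 := by
      gcongr
    have h6 : κ ≤ ‖drift φ r (ϑ t)‖ ^ 2 / R / policy φ (ϑ t) ystar ^ 2 := by
      rw [le_div_iff₀ (by positivity), le_div_iff₀ hR]
      refine le_trans (le_of_eq ?_) h5
      rw [hκ]; ring
    rw [neg_div, mul_one]
    linarith

end TwoValued

/-! ### Constants, exponents and the lower bound on the time. -/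

variable {Y : Type*} [Fintype Y] {D : ℕ} {φ : Y → EuclideanSpace ℝ (Fin D)} {r : Y → ℝ}
  {ystar ymed ybad : Y} {Ybad : Finset Y} {θ₀ : EuclideanSpace ℝ (Fin D)}
  {ϑ : ℝ → EuclideanSpace ℝ (Fin D)}

lemma constAlpha_mem_Ioo {Y : Type*} {D : ℕ} {φ : Y → EuclideanSpace ℝ (Fin D)} {ystar ymed : Y}
    (hmed : φ ymed ≠ 0) (hneg : inner ℝ (φ ystar) (φ ymed) < 0) :
    constAlpha φ ystar ymed ∈ Set.Ioo (0 : ℝ) (1 / 13) := by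
  have hb : 0 < ‖φ ymed‖ ^ 2 := by have := norm_pos_iff.2 hmed; positivity
  rw [constAlpha]
  constructor
  · apply div_pos <;> linarith
  · rw [div_lt_div_iff₀ (by linarith) (by norm_num)]
    linarith

lemma featureBound_pos (hstar : φ ystar ≠ 0) : 0 < featureBound φ :=
  (norm_pos_iff.2 hstar).trans_le (norm_le_featureBound φ ystar)

/-- The lower bound for the time of reaching the reward `r(star) - ε`, up to the power
`p ^ (-(14 / 13) - α)` of the initial probability `p`. -/
noncomputable def lowerConst (φ : Y → EuclideanSpace ℝ (Fin D)) (r : Y → ℝ) (ystar ymed ybad : Y)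
    (ε : ℝ) : ℝ :=
  r ymed * constM φ r ystar ymed ybad ^ (14 / 13 + constAlpha φ ystar ymed) *
      (1 - Real.exp (-2 * (gapStar r ystar ymed - ε))) /
    (4 * featureBound φ ^ 2 * (gapStar r ystar ymed + gapBad r ymed ybad) *
      (26 / r ymed ^ 2) ^ (13 * constAlpha φ ystar ymed / 7))

/-- Exponent count: `1 + 7/13 * (1/7 + 13α/7) = 14/13 + α`. The power `1/7` of `20 / ρm ^ 2` is
absorbed by `M`, since `1.6 / 40 = 1 / 25`. -/
lemma rpow_bound {ρ M ρm q α : ℝ} (hρ : 0 < ρ) (hM : 0 < M) (hr : 0 < ρm)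
    (hMr : M ≤ ρm ^ (2 / 7 : ℝ) / (40 * ρm)) (hα : 0 < α) (hq0 : 0 ≤ q)
    (hq : q ≤ 20 / ρm ^ 2 * (ρ / M) ^ (7 / 13 : ℝ)) :
    ρ * q ^ (1 / 7 + 13 * α / 7) ≤
      (26 / ρm ^ 2) ^ (13 * α / 7) / (25 * ρm) * (ρ / M) ^ (14 / 13 + α) := by
  have hu : 0 < ρ / M := div_pos hρ hM
  set u := ρ / M with hu_def
  have hρ' : ρ = M * u := by rw [hu_def]; field_simp
  have h20 : (20 : ℝ) ^ (1 / 7 : ℝ) ≤ 1.6 := by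
    calc (20 : ℝ) ^ (1 / 7 : ℝ) ≤ ((1.6 : ℝ) ^ (7 : ℝ)) ^ (1 / 7 : ℝ) := by
          gcongr
          rw [show (7 : ℝ) = ((7 : ℕ) : ℝ) by norm_num, Real.rpow_natCast]
          norm_num
      _ = 1.6 := by rw [← Real.rpow_mul (by norm_num)]; norm_num
  have h1 : M * (20 / ρm ^ 2) ^ (1 / 7 : ℝ) ≤ 1 / (25 * ρm) := by
    have e : (ρm ^ 2) ^ (1 / 7 : ℝ) = ρm ^ (2 / 7 : ℝ) := by
      rw [← Real.rpow_natCast, ← Real.rpow_mul hr.le]; norm_num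
    rw [Real.div_rpow (by norm_num) (by positivity), e]
    have hp : 0 < ρm ^ (2 / 7 : ℝ) := by positivity
    calc M * (20 ^ (1 / 7 : ℝ) / ρm ^ (2 / 7 : ℝ))
        ≤ ρm ^ (2 / 7 : ℝ) / (40 * ρm) * (1.6 / ρm ^ (2 / 7 : ℝ)) := by gcongr
      _ = 1 / (25 * ρm) := by field_simp; norm_num
  calc ρ * q ^ (1 / 7 + 13 * α / 7)
      ≤ ρ * (20 / ρm ^ 2 * u ^ (7 / 13 : ℝ)) ^ (1 / 7 + 13 * α / 7) := by gcongr
    _ = (M * (20 / ρm ^ 2) ^ (1 / 7 : ℝ)) * (20 / ρm ^ 2) ^ (13 * α / 7) * u ^ (14 / 13 + α) := by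
        rw [Real.mul_rpow (by positivity) (by positivity), ← Real.rpow_mul hu.le,
          Real.rpow_add (by positivity : (0 : ℝ) < 20 / ρm ^ 2),
          show 14 / 13 + α = 7 / 13 * (1 / 7 + 13 * α / 7) + 1 by ring, Real.rpow_add_one hu.ne']
        rw [hρ']; ring
    _ ≤ 1 / (25 * ρm) * (26 / ρm ^ 2) ^ (13 * α / 7) * u ^ (14 / 13 + α) := by
        gcongr; norm_num
    _ = _ := by ring

lemma lowerBound_le {ρ M ρm N Δ K e p α : ℝ} (hρ : 0 < ρ) (hM : 0 < M) (hr : 0 < ρm) (hN : 0 < N)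
    (hΔ : 0 < Δ) (hK : 0 < K) (he : 0 < e) (hp0 : 0 < p)
    (hp : p ≤ K / (25 * ρm) * (ρ / M) ^ (14 / 13 + α)) :
    ρm * M ^ (14 / 13 + α) * e / (4 * N * Δ * K) * ρ ^ (-(14 / 13) - α) ≤
      e / (10 * N * Δ * p) := by
  have hexp : ρ ^ (-(14 / 13) - α) = (ρ ^ (14 / 13 + α))⁻¹ := by
    rw [← Real.rpow_neg hρ.le]; congr 1; ring
  rw [Real.div_rpow hρ.le hM.le] at hp
  rw [hexp]
  have hU : 0 < ρ ^ (14 / 13 + α) := by positivity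
  have hV : 0 < M ^ (14 / 13 + α) := by positivity
  generalize ρ ^ (14 / 13 + α) = U at *
  generalize M ^ (14 / 13 + α) = V at *
  calc ρm * V * e / (4 * N * Δ * K) * U⁻¹
      = 1 / 10 * (e / (10 * N * Δ * (K / (25 * ρm) * (U / V)))) := by field_simp; norm_num
    _ ≤ 1 * (e / (10 * N * Δ * (K / (25 * ρm) * (U / V)))) := by gcongr; norm_num
    _ ≤ 1 * (e / (10 * N * Δ * p)) := by gcongr
    _ = _ := one_mul _

variable [DecidableEq Y]

lemma constM_pos (hR : RewardStructure r ystar ymed Ybad) (hb : ybad ∈ Ybad)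
    (hmed : φ ymed ≠ 0) : 0 < constM φ r ystar ymed ybad := by
  have hD₂ : 0 < gapBad r ymed ybad := hR.med_pos.trans_le (hR.med_le_gapBad hb)
  have hD₁ := hR.gapStar_pos
  have hN := featureBound_pos hmed
  have hn := norm_pos_iff.2 hmed
  have hr := hR.med_pos
  exact lt_min one_pos (by positivity)

lemma lowerConst_pos (hR : RewardStructure r ystar ymed Ybad) (hb : ybad ∈ Ybad)
    (hmed : φ ymed ≠ 0) {ε : ℝ} (hε : ε < gapStar r ystar ymed) :
    0 < lowerConst φ r ystar ymed ybad ε := by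
  have hD₂ : 0 < gapBad r ymed ybad := hR.med_pos.trans_le (hR.med_le_gapBad hb)
  have hD₁ := hR.gapStar_pos
  have hN := featureBound_pos hmed
  have hM := constM_pos hR hb hmed (φ := φ)
  have hr := hR.med_pos
  have he : 0 < 1 - Real.exp (-2 * (gapStar r ystar ymed - ε)) := by
    rw [sub_pos, Real.exp_lt_one_iff]; linarith
  rw [lowerConst]
  positivity

set_option maxHeartbeats 1000000 in
lemma IsGradientFlow.lowerConst_le (h : IsGradientFlow φ r θ₀ ϑ)
    (hr : ∀ y, r y ∈ Set.Icc (-1 : ℝ) 1) (hR : RewardStructure r ystar ymed Ybad)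
    (hb : ybad ∈ Ybad) (hF : FeatureStructure φ ystar ymed Ybad) (hmed : φ ymed ≠ 0)
    (hI : InitialPolicy φ r ystar ymed Ybad ybad θ₀) {ε T : ℝ} (hε : ε < gapStar r ystar ymed)
    (hT : 0 ≤ T) (hV : r ystar - ε ≤ expectedReward φ r (ϑ T)) :
    lowerConst φ r ystar ymed ybad ε *
      policy φ θ₀ ystar ^ (-(14 / 13) - constAlpha φ ystar ymed) ≤ T := by
  have hne : Nonempty Y := ⟨ystar⟩
  have hD₂ : 0 < gapBad r ymed ybad := hR.med_pos.trans_le (hR.med_le_gapBad hb)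
  have hmD₂ := hR.med_le_gapBad hb
  have hD₁ := hR.gapStar_pos
  have hN := featureBound_pos hmed
  have hM := constM_pos hR hb hmed (φ := φ)
  have hn := norm_pos_iff.2 hmed
  have hrm := hR.med_pos
  have hrm1 := (hr ymed).2
  obtain ⟨hα0, hα1⟩ := constAlpha_mem_Ioo hmed hF.inner_neg
  have hD₁1 : gapStar r ystar ymed ≤ 1 := by rw [gapStar]; linarith [(hr ystar).2]
  have hD2 : gapStar r ystar ymed + gapBad r ymed ybad ≤ 2 := by
    rw [gapStar, gapBad]; linarith [(hr ystar).2, (hr ybad).1]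
  have hM1 : constM φ r ystar ymed ybad ≤ 1 := min_le_left _ _
  have hMb : constM φ r ystar ymed ybad ≤ ‖φ ymed‖ ^ 2 * r ymed ^ (2 / 7 : ℝ) *
    (40 * featureBound φ ^ 2 * (gapStar r ystar ymed + gapBad r ymed ybad))⁻¹ := min_le_right _ _
  have hlow := hI.bad_lower
  have hup := hI.bad_upper
  have hs0 := policy_pos φ θ₀ ystar
  have hA := hR.advantage_med hb θ₀ (φ := φ)
  set α := constAlpha φ ystar ymed with hα
  set M := constM φ r ystar ymed ybad with hMdef
  set D₁ := gapStar r ystar ymed with hD₁def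
  set D₂ := gapBad r ymed ybad with hD₂def
  set ρ := policy φ θ₀ ystar with hρ
  set β := ∑ z ∈ Ybad, policy φ θ₀ z with hβ
  set N := featureBound φ ^ 2 with hNdef
  have hN0 : 0 < N := by positivity
  have hbN : ‖φ ymed‖ ^ 2 ≤ N := pow_le_pow_left₀ hn.le (norm_le_featureBound φ _) 2
  have hrp : r ymed ^ (2 / 7 : ℝ) ≤ 1 := Real.rpow_le_one hrm.le hrm1 (by norm_num)
  have hMN : M * N * (D₁ + D₂) ≤ ‖φ ymed‖ ^ 2 / 40 := by
    rw [← div_eq_mul_inv, le_div_iff₀ (by positivity)] at hMb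
    have : ‖φ ymed‖ ^ 2 * r ymed ^ (2 / 7 : ℝ) ≤ ‖φ ymed‖ ^ 2 * 1 := by gcongr
    linarith
  have hMr : M ≤ r ymed ^ (2 / 7 : ℝ) / (40 * r ymed) := by
    refine hMb.trans ?_
    rw [← div_eq_mul_inv, div_le_div_iff₀ (by positivity) (by positivity)]
    have h1 : ‖φ ymed‖ ^ 2 * r ymed ≤ N * (D₁ + D₂) := by gcongr; linarith
    have h2 := mul_le_mul_of_nonneg_left h1 (by positivity : 0 ≤ 40 * r ymed ^ (2 / 7 : ℝ))
    linarith
  -- With this variable both scales are natural powers: `ρ = M w ^ 13`, and the assumed lower bound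
  -- on the bad mass becomes `2 w ^ 7 ≤ D₂ β`.
  set w := (ρ / M) ^ (1 / 13 : ℝ) with hw
  have hu : 0 < ρ / M := div_pos hs0 hM
  have hw0 : 0 < w := by positivity
  have hw13 : ρ = M * w ^ 13 := by
    rw [hw, ← Real.rpow_natCast, ← Real.rpow_mul hu.le]
    norm_num
    field_simp
  have hw7 : w ^ 7 = (ρ / M) ^ (7 / 13 : ℝ) := by
    rw [hw, ← Real.rpow_natCast, ← Real.rpow_mul hu.le]
    norm_num
  have hlow1 : 2 * w ^ 7 ≤ D₂ * β := by
    have h1 := (le_max_left _ _).trans hlow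
    rw [div_le_iff₀ (by positivity)] at h1
    rw [hw7, Real.div_rpow hs0.le hM.le, ← mul_div_assoc, div_le_iff₀ (by positivity)]
    linarith
  have hlow2 : 0.05 * r ymed ≤ β := (le_max_right _ _).trans hlow
  have hβ0 : 0 < β := by linarith
  have hβ1 : β ≤ 0.1 := by linarith
  have hDβ : D₂ * β ≤ D₂ * 0.1 := by gcongr
  have hw2 : w ^ 7 ≤ 0.05 * (D₁ + D₂) := by linarith
  have hw1 : w ^ 7 ≤ 0.1 := by linarith
  have hρw : ρ ≤ 0.15 * w ^ 7 := by
    have h6 := pow_six_le_of_pow_seven_le hw0.le hw1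
    calc ρ = M * (w ^ 6 * w ^ 7) := by rw [hw13]; ring
      _ ≤ 1 * (0.15 * w ^ 7) := by gcongr
      _ = _ := one_mul _
  have hinit : expectedReward φ r θ₀ < r ymed := by
    rw [advantage] at hA
    have h1 : D₁ * ρ ≤ 1 * ρ := by gcongr
    have h7 : 0 < w ^ 7 := by positivity
    linarith
  obtain ⟨t₁, ht₁, hbelow, hp1, hp2⟩ := h.exists_star_small hR hb hF hw0 hM hM1 hMN hw1 hw2 hD₁1
    hw13 hβ1 (γ := 1 / 7 + 13 * α / 7) (by positivity) (by linarith) hT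
    (by rw [hD₁def, gapStar] at hε; linarith)
  have htime := h.le_time_of_star_small hR hb hF hN hβ1 hD2 ht₁ hbelow hinit
    (by linarith) (sub_pos.2 hε) (by rw [hD₁def, gapStar]; linarith)
  have hp0 := policy_pos φ (ϑ t₁) ystar
  set p := policy φ (ϑ t₁) ystar with hp
  have hpP : p ≤ (26 / r ymed ^ 2) ^ (13 * α / 7) / (25 * r ymed) * (ρ / M) ^ (14 / 13 + α) := by
    refine hp2.trans (rpow_bound hs0 hM hrm hMr hα0 (by positivity) ?_)
    rw [hw7.symm, div_div, div_mul_eq_mul_div, div_le_div_iff₀ (by positivity) (by positivity)]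
    -- The factor `20 / r ymed ^ 2` comes from `D₂ ≥ r ymed` and `β ≥ 0.05 r ymed`.
    have h1 : r ymed * (0.05 * r ymed) ≤ D₂ * β := by gcongr
    have h2 := mul_le_mul_of_nonneg_left h1 (by positivity : 0 ≤ 20 * w ^ 7)
    linarith
  have he : 0 < 1 - Real.exp (-2 * (D₁ - ε)) := by
    rw [sub_pos, Real.exp_lt_one_iff]; linarith
  set K := (26 / r ymed ^ 2) ^ (13 * α / 7) with hK
  have hK0 : 0 < K := by positivity
  set e := 1 - Real.exp (-2 * (D₁ - ε)) with hedef
  calc lowerConst φ r ystar ymed ybad ε * ρ ^ (-(14 / 13) - α)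
      ≤ e / (10 * N * (D₁ + D₂) * p) := lowerBound_le hs0 hM hrm hN0 (add_pos hD₁ hD₂) hK0 he hp0 hpP
    _ ≤ T - t₁ := htime
    _ ≤ T := by linarith [ht₁.1]

end SoftmaxFlow

/-! ### Hitting times and comparison of the rates. -/

namespace SoftmaxFlow

lemma le_initialTime {Y : Type*} [Fintype Y] {D : ℕ} {φ : Y → EuclideanSpace ℝ (Fin D)} {r : Y → ℝ}
    {ϑ : ℝ → EuclideanSpace ℝ (Fin D)} {c L : ℝ}
    (h : ∀ t, 0 ≤ t → c ≤ expectedReward φ r (ϑ t) → L ≤ t) :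
    ENNReal.ofReal L ≤ initialTime φ r ϑ c :=
  le_iInf₂ fun t ht => ENNReal.ofReal_le_ofReal (h t ht.1 ht.2)

lemma isLittleO_inv_rpow {α : ℝ} (hα : 0 < α) :
    Asymptotics.IsLittleO (𝓝[>] (0 : ℝ)) (fun p : ℝ => p⁻¹)
      (fun p : ℝ => p ^ (-(14 / 13) - α)) := by
  rw [Asymptotics.isLittleO_iff_tendsto']
  · have h1 : Filter.Tendsto (fun p : ℝ => p ^ (1 / 13 + α)) (𝓝[>] 0) (𝓝 0) := by
      have := (Real.continuousAt_rpow_const 0 (1 / 13 + α) (Or.inr (by positivity))).tendsto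
      rw [Real.zero_rpow (by positivity)] at this
      exact this.mono_left nhdsWithin_le_nhds
    refine h1.congr' ?_
    filter_upwards [self_mem_nhdsWithin] with p hp
    have hp' : 0 < p := hp
    rw [← Real.rpow_neg_one, ← Real.rpow_sub hp']
    congr 1; ring
  · filter_upwards [self_mem_nhdsWithin] with p hp h
    exact absurd h (Real.rpow_pos_of_pos hp _).ne'

/-- The rate `p⁻¹` stays below the rate `p ^ (-(14 / 13) - α)` by any prescribed margin. -/
lemma exists_rate_gap {α c C : ℝ} (hα : 0 < α) (hc : 0 < c) (hC : 0 < C) (T : ℝ) :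
    ∃ δ : ℝ, 0 < δ ∧ ∀ p, 0 < p → p < δ → C * p⁻¹ + T ≤ c * p ^ (-(14 / 13) - α) := by
  have h1 := (isLittleO_inv_rpow hα).bound (show 0 < c / (C + 1) by positivity)
  have h2 := tendsto_inv_nhdsGT_zero.eventually_ge_atTop T
  obtain ⟨δ, hδ, h⟩ := mem_nhdsGT_iff_exists_Ioo_subset.1 (h1.and h2)
  refine ⟨δ, hδ, fun p hp hpδ => ?_⟩
  obtain ⟨h3, h4⟩ := h ⟨hp, hpδ⟩
  rw [Real.norm_of_nonneg (inv_nonneg.2 hp.le),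
    Real.norm_of_nonneg (Real.rpow_nonneg hp.le _), div_mul_eq_mul_div,
    le_div_iff₀ (by positivity)] at h3
  linarith

section

variable {Y : Type*} [Fintype Y] [DecidableEq Y] {D : ℕ} {φ : Y → EuclideanSpace ℝ (Fin D)}
  {r rP : Y → ℝ} {ystar ymed ybad : Y} {Ybad : Finset Y} {θ₀ : EuclideanSpace ℝ (Fin D)}
  {ϑ : ℝ → EuclideanSpace ℝ (Fin D)}

lemma RewardStructure.eq_of_ne_star (hR : RewardStructure r ystar ymed Ybad) (hb : ybad ∈ Ybad)
    (hrP : ∀ y, y ≠ ymed → rP y = r y) (hrPmed : rP ymed = r ybad) {y : Y} (hy : y ≠ ystar) :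
    rP y = r ybad := by
  by_cases h : y = ymed
  · rw [h, hrPmed]
  · rw [hrP y h]
    have : y ∈ ({ystar, ymed} : Finset Y) ∪ Ybad := hR.cover ▸ Finset.mem_univ y
    simp only [Finset.mem_union, Finset.mem_insert, Finset.mem_singleton, hy, h, false_or] at this
    exact hR.bad_const _ this _ hb

/-- If the medium outcome is rewarded like the bad ones, then the flow is fast. -/
lemma IsGradientFlow.initialTime_le (h : IsGradientFlow φ rP θ₀ ϑ)
    (hR : RewardStructure r ystar ymed Ybad) (hb : ybad ∈ Ybad)
    (hF : FeatureStructure φ ystar ymed Ybad) (hstar : φ ystar ≠ 0)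
    (hrP : ∀ y, y ≠ ymed → rP y = r y) (hrPmed : rP ymed = r ybad) {ε : ℝ} (hε : 0 < ε) :
    initialTime φ r ϑ (r ystar - ε) ≤
      ENNReal.ofReal ((r ystar - r ybad) / (ε ^ 2 * ‖φ ystar‖ ^ 2) * (policy φ θ₀ ystar)⁻¹) := by
  have hne : Nonempty Y := ⟨ystar⟩
  have hgap : 0 < r ystar - r ybad := by
    linarith [hR.star_gt_med, hR.med_pos, hR.bad_nonpos _ hb]
  have hPstar : rP ystar = r ybad + (r ystar - r ybad) := by
    rw [hrP _ hR.star_ne_med]; ring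
  have hP : ∀ y, y ≠ ystar → rP y = r ybad := fun y hy => hR.eq_of_ne_star hb hrP hrPmed hy
  have hinner : ∀ y, y ≠ ystar → inner ℝ (φ ystar) (φ y) ≤ 0 := by
    intro y hy
    by_cases hm : y = ymed
    · rw [hm]; exact hF.inner_neg.le
    · have : y ∈ ({ystar, ymed} : Finset Y) ∪ Ybad := hR.cover ▸ Finset.mem_univ y
      simp only [Finset.mem_union, Finset.mem_insert, Finset.mem_singleton, hy, hm,
        false_or] at this
      rw [real_inner_comm, hF.bad_orthogonal y this ystar hy.symm]
  -- Missing mass `η = ε / R`, with `R` the proxy gap, costs exactly `ε` of proxy reward; the ground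
  -- truth reward dominates the proxy pointwise.
  obtain ⟨t, ht, hst⟩ := h.exists_star_large hPstar hP hgap hinner hstar (div_pos hε hgap)
  have hn := norm_pos_iff.2 hstar
  have hs := policy_pos φ θ₀ ystar
  have hV : r ystar - ε ≤ expectedReward φ r (ϑ t) := by
    have h1 := expectedReward_of_two_valued (φ := φ) hPstar hP (ϑ t)
    have h2 : expectedReward φ rP (ϑ t) ≤ expectedReward φ r (ϑ t) := by
      refine Finset.sum_le_sum fun y _ => mul_le_mul_of_nonneg_left ?_ (policy_pos φ _ y).le
      by_cases hm : y = ymed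
      · rw [hm, hrPmed]
        linarith [hR.med_pos, hR.bad_nonpos _ hb]
      · exact (hrP y hm).le
    have h3 := mul_le_mul_of_nonneg_left hst hgap.le
    rw [mul_sub, mul_div_cancel₀ _ hgap.ne'] at h3
    linarith
  refine (iInf₂_le t ⟨ht.1, hV⟩).trans (ENNReal.ofReal_le_ofReal (ht.2.trans (le_of_eq ?_)))
  field_simp

/-- The part of `constK` depending on `θ₀` is a factor at least 1 in the denominator. Dropping it
gives a stronger bound with a constant independent of `θ₀`, which serves both forms of the lower
bound. -/
lemma lowerBound_le_lowerConst (hR : RewardStructure r ystar ymed Ybad) (hb : ybad ∈ Ybad)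
    (hneg : inner ℝ (φ ystar) (φ ymed) < 0) {ε : ℝ} (hε : ε < gapStar r ystar ymed) :
    r ymed * constM φ r ystar ymed ybad ^ (14 / 13 + constAlpha φ ystar ymed) *
        (1 - Real.exp (-2 * (gapStar r ystar ymed - ε))) /
      (4 * featureBound φ ^ 2 * (gapStar r ystar ymed + gapBad r ymed ybad) *
        constK φ r ystar ymed θ₀) ≤ lowerConst φ r ystar ymed ybad ε := by
  have hne : Nonempty Y := ⟨ystar⟩
  have hmed : φ ymed ≠ 0 := by
    rintro h0
    rw [h0, inner_zero_right] at hneg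
    exact lt_irrefl _ hneg
  have hD₂ : 0 < gapBad r ymed ybad := hR.med_pos.trans_le (hR.med_le_gapBad hb)
  have hD₁ := hR.gapStar_pos
  have hN := featureBound_pos hmed
  have hM := constM_pos hR hb hmed (φ := φ)
  have hr := hR.med_pos
  have he : 0 < 1 - Real.exp (-2 * (gapStar r ystar ymed - ε)) := by
    rw [sub_pos, Real.exp_lt_one_iff]; linarith
  have hβ : 0 ≤ ∑ z ∈ Ybad, policy φ θ₀ z := Finset.sum_nonneg fun z _ => (policy_pos φ _ z).le
  have hm := policy_pos φ θ₀ ymed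
  have hA : 0 ≤ advantage φ r θ₀ ystar := by
    rw [hR.advantage_star hb]; positivity
  have hc : 0 ≤ ‖φ ystar‖ ^ 2 - inner ℝ (φ ystar) (φ ymed) := by
    have := sq_nonneg ‖φ ystar‖
    linarith
  rw [lowerConst, constK]
  gcongr
  refine le_mul_of_one_le_right (by positivity) ?_
  have : 0 ≤ ‖φ ymed‖ ^ 2 * policy φ θ₀ ymed ^ 2 /
      (8 * (‖φ ystar‖ ^ 2 - inner ℝ (φ ystar) (φ ymed)) * advantage φ r θ₀ ystar) := by positivity
  linarith

end

end SoftmaxFlow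

theorem mainTheorem2 {Y : Type*} [Fintype Y] [DecidableEq Y] {D : ℕ}
    (φ : Y → EuclideanSpace ℝ (Fin D)) (hφ : ∀ y, φ y ≠ 0)
    (rG : Y → ℝ) (hrG : ∀ y, rG y ∈ Set.Icc (-1 : ℝ) 1)
    (ystar ymed : Y) (Ybad : Finset Y)
    (hR : SoftmaxFlow.RewardStructure rG ystar ymed Ybad)
    (hF : SoftmaxFlow.FeatureStructure φ ystar ymed Ybad)
    (ybad : Y) (hybad : ybad ∈ Ybad)
    (rP : Y → ℝ) (hrP : ∀ y, y ≠ ymed → rP y = rG y)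
    (hrPmed : rP ymed = Ybad.inf' ⟨ybad, hybad⟩ rG)
    (ε : ℝ) (hε : ε ∈ Set.Ioo (0 : ℝ) (SoftmaxFlow.gapStar rG ystar ymed)) :
    -- the exponent
    SoftmaxFlow.constAlpha φ ystar ymed ∈ Set.Ioo (0 : ℝ) (1 / 13) ∧
    -- Case I, explicit lower bound
    (∀ θ₀ : EuclideanSpace ℝ (Fin D),
      SoftmaxFlow.InitialPolicy φ rG ystar ymed Ybad ybad θ₀ →
      ∀ θ : ℝ → EuclideanSpace ℝ (Fin D), SoftmaxFlow.IsGradientFlow φ rG θ₀ θ →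
        ENNReal.ofReal
          (rG ymed *
              SoftmaxFlow.constM φ rG ystar ymed ybad ^
                (14 / 13 + SoftmaxFlow.constAlpha φ ystar ymed) *
              (1 - Real.exp (-2 * (SoftmaxFlow.gapStar rG ystar ymed - ε))) /
            (4 * SoftmaxFlow.featureBound φ ^ 2 *
              (SoftmaxFlow.gapStar rG ystar ymed + SoftmaxFlow.gapBad rG ymed ybad) *
              SoftmaxFlow.constK φ rG ystar ymed θ₀) *
            SoftmaxFlow.policy φ θ₀ ystar ^
              (-(14 / 13) - SoftmaxFlow.constAlpha φ ystar ymed))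
          ≤ SoftmaxFlow.initialTime φ rG θ (rG ystar - ε)) ∧
    -- Case I, asymptotic form, with a constant independent of the initial parameters
    (∃ c : ℝ, 0 < c ∧ ∀ θ₀ : EuclideanSpace ℝ (Fin D),
      SoftmaxFlow.InitialPolicy φ rG ystar ymed Ybad ybad θ₀ →
      ∀ θ : ℝ → EuclideanSpace ℝ (Fin D), SoftmaxFlow.IsGradientFlow φ rG θ₀ θ →
        ENNReal.ofReal
          (c * SoftmaxFlow.policy φ θ₀ ystar ^
            (-(14 / 13) - SoftmaxFlow.constAlpha φ ystar ymed))
          ≤ SoftmaxFlow.initialTime φ rG θ (rG ystar - ε)) ∧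
    -- Case II, explicit upper bound
    (∀ θ₀ : EuclideanSpace ℝ (Fin D),
      SoftmaxFlow.InitialPolicy φ rG ystar ymed Ybad ybad θ₀ →
      ∀ θ : ℝ → EuclideanSpace ℝ (Fin D), SoftmaxFlow.IsGradientFlow φ rP θ₀ θ →
        SoftmaxFlow.initialTime φ rG θ (rG ystar - ε) ≤
          ENNReal.ofReal
            ((rG ystar + 1) ^ 2 /
              (ε ^ 2 * (rP ystar - SoftmaxFlow.expectedReward φ rP θ₀) * ‖φ ystar‖ ^ 2) *
              (SoftmaxFlow.policy φ θ₀ ystar)⁻¹)) ∧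
    -- Case II, asymptotic form, with a constant independent of the initial parameters
    (∃ C : ℝ, 0 < C ∧ ∀ θ₀ : EuclideanSpace ℝ (Fin D),
      SoftmaxFlow.InitialPolicy φ rG ystar ymed Ybad ybad θ₀ →
      ∀ θ : ℝ → EuclideanSpace ℝ (Fin D), SoftmaxFlow.IsGradientFlow φ rP θ₀ θ →
        SoftmaxFlow.initialTime φ rG θ (rG ystar - ε) ≤
          ENNReal.ofReal (C * (SoftmaxFlow.policy φ θ₀ ystar)⁻¹)) ∧
    -- the upper rate is of smaller order than the lower rate
    Asymptotics.IsLittleO (𝓝[>] (0 : ℝ)) (fun p : ℝ => p⁻¹)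
      (fun p : ℝ => p ^ (-(14 / 13) - SoftmaxFlow.constAlpha φ ystar ymed)) ∧
    -- the gap is arbitrarily large
    (∀ T : ℝ, 0 < T → ∃ δ : ℝ, 0 < δ ∧ ∀ θ₀ : EuclideanSpace ℝ (Fin D),
      SoftmaxFlow.InitialPolicy φ rG ystar ymed Ybad ybad θ₀ →
      SoftmaxFlow.policy φ θ₀ ystar < δ →
      ∀ θ θ' : ℝ → EuclideanSpace ℝ (Fin D),
        SoftmaxFlow.IsGradientFlow φ rG θ₀ θ → SoftmaxFlow.IsGradientFlow φ rP θ₀ θ' →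
        SoftmaxFlow.initialTime φ rG θ' (rG ystar - ε) + ENNReal.ofReal T ≤
          SoftmaxFlow.initialTime φ rG θ (rG ystar - ε)) := by
  
  have hne : Nonempty Y := ⟨ystar⟩
  have hmed := hφ ymed
  have hstar := hφ ystar
  have hα := SoftmaxFlow.constAlpha_mem_Ioo hmed hF.inner_neg
  have hrPmed' : rP ymed = rG ybad := by
    rw [hrPmed]
    refine le_antisymm (Finset.inf'_le _ hybad) (Finset.le_inf' _ _ fun y hy => ?_)
    exact (hR.bad_const _ hybad _ hy).le
  have hgap : 0 < rG ystar - rG ybad := by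
    linarith [hR.star_gt_med, hR.med_pos, hR.bad_nonpos _ hybad]
  have hn := norm_pos_iff.2 hstar
  have hc := SoftmaxFlow.lowerConst_pos hR hybad hmed hε.2
  have hC : 0 < (rG ystar - rG ybad) / (ε ^ 2 * ‖φ ystar‖ ^ 2) := by
    have := hε.1
    positivity
  have hlower : ∀ θ₀ : EuclideanSpace ℝ (Fin D),
      SoftmaxFlow.InitialPolicy φ rG ystar ymed Ybad ybad θ₀ →
      ∀ θ : ℝ → EuclideanSpace ℝ (Fin D), SoftmaxFlow.IsGradientFlow φ rG θ₀ θ →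
        ENNReal.ofReal (SoftmaxFlow.lowerConst φ rG ystar ymed ybad ε *
            SoftmaxFlow.policy φ θ₀ ystar ^ (-(14 / 13) - SoftmaxFlow.constAlpha φ ystar ymed))
          ≤ SoftmaxFlow.initialTime φ rG θ (rG ystar - ε) := fun θ₀ hI θ h =>
    SoftmaxFlow.le_initialTime fun t ht hV => h.lowerConst_le hrG hR hybad hF hmed hI hε.2 ht hV
  have hupper : ∀ θ₀ : EuclideanSpace ℝ (Fin D),
      ∀ θ : ℝ → EuclideanSpace ℝ (Fin D), SoftmaxFlow.IsGradientFlow φ rP θ₀ θ →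
        SoftmaxFlow.initialTime φ rG θ (rG ystar - ε) ≤
          ENNReal.ofReal ((rG ystar - rG ybad) / (ε ^ 2 * ‖φ ystar‖ ^ 2) *
            (SoftmaxFlow.policy φ θ₀ ystar)⁻¹) := fun θ₀ θ h =>
    h.initialTime_le hR hybad hF hstar hrP hrPmed' hε.1
  refine ⟨hα, fun θ₀ hI θ h => ?_, ⟨_, hc, hlower⟩, fun θ₀ hI θ h => ?_,
    ⟨_, hC, fun θ₀ _ => hupper θ₀⟩, SoftmaxFlow.isLittleO_inv_rpow hα.1, fun T hT => ?_⟩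
  · refine (ENNReal.ofReal_le_ofReal ?_).trans (hlower θ₀ hI θ h)
    have := SoftmaxFlow.policy_pos φ θ₀ ystar
    gcongr
    exact SoftmaxFlow.lowerBound_le_lowerConst hR hybad hF.inner_neg hε.2
  · refine (hupper θ₀ θ h).trans (ENNReal.ofReal_le_ofReal ?_)
    have hs := SoftmaxFlow.policy_pos φ θ₀ ystar
    have hs1 : SoftmaxFlow.policy φ θ₀ ystar < 1 := by
      have h1 := hR.sum_policy_eq (φ := φ) θ₀
      have h2 := SoftmaxFlow.policy_pos φ θ₀ ymed
      have h3 : 0 ≤ ∑ z ∈ Ybad, SoftmaxFlow.policy φ θ₀ z :=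
        Finset.sum_nonneg fun z _ => (SoftmaxFlow.policy_pos φ _ z).le
      linarith
    have hPstar : rP ystar = rG ybad + (rG ystar - rG ybad) := by
      rw [hrP _ hR.star_ne_med]; ring
    -- The uniform bound is the sharper one: with `R = rG ystar - rG ybad`, the stated constant has
    -- `(rG ystar + 1) ^ 2 / (R (1 - s))` in place of `R`, and `R ≤ rG ystar + 1`.
    have hA : rP ystar - SoftmaxFlow.expectedReward φ rP θ₀ =
        (rG ystar - rG ybad) * (1 - SoftmaxFlow.policy φ θ₀ ystar) := by
      rw [SoftmaxFlow.expectedReward_of_two_valued hPstar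
        fun y hy => hR.eq_of_ne_star hybad hrP hrPmed' hy, hPstar]
      ring
    have hε0 := hε.1
    have h1s : 0 < 1 - SoftmaxFlow.policy φ θ₀ ystar := by linarith
    rw [hA]
    refine mul_le_mul_of_nonneg_right ?_ (inv_nonneg.2 hs.le)
    rw [div_le_div_iff₀ (by positivity) (by positivity)]
    have h1 : (rG ystar - rG ybad) ^ 2 ≤ (rG ystar + 1) ^ 2 := by
      have := (hrG ybad).1
      gcongr; linarith
    have h2 : (rG ystar - rG ybad) ^ 2 * (1 - SoftmaxFlow.policy φ θ₀ ystar) ≤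
        (rG ystar + 1) ^ 2 * 1 := by
      gcongr; linarith
    have h3 := mul_le_mul_of_nonneg_right h2 (by positivity : 0 ≤ ε ^ 2 * ‖φ ystar‖ ^ 2)
    linarith
  · obtain ⟨δ, hδ, hgap'⟩ := SoftmaxFlow.exists_rate_gap hα.1 hc hC T
    refine ⟨δ, hδ, fun θ₀ hI hp θ θ' h h' => ?_⟩
    have hs := SoftmaxFlow.policy_pos φ θ₀ ystar
    calc SoftmaxFlow.initialTime φ rG θ' (rG ystar - ε) + ENNReal.ofReal T
        ≤ ENNReal.ofReal ((rG ystar - rG ybad) / (ε ^ 2 * ‖φ ystar‖ ^ 2) *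
            (SoftmaxFlow.policy φ θ₀ ystar)⁻¹) + ENNReal.ofReal T := by
          gcongr
          exact hupper θ₀ θ' h'
      _ = ENNReal.ofReal ((rG ystar - rG ybad) / (ε ^ 2 * ‖φ ystar‖ ^ 2) *
            (SoftmaxFlow.policy φ θ₀ ystar)⁻¹ + T) :=
          (ENNReal.ofReal_add (by positivity) hT.le).symm
      _ ≤ _ := ENNReal.ofReal_le_ofReal (hgap' _ hs hp)
      _ ≤ _ := hlower θ₀ hI θ h
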